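/- Let $h>0$, $0<\alpha\le 1$ and $\cos^{-1}(\alpha/2)\le\theta<\pi$, and let $K=K_{\alpha,\theta,h}$ be the closed triangle with vertices $p_1=(0,0)$, $p_2=(h,0)$, $p_3=(\alpha h\cos\theta,\alpha h\sin\theta)$. Let $N\ge 1$ be an integer and let $\mathcal T^h$ be the uniform triangulation of $K$ with $N$ subdivisions of each side: with the grid points $q_{i,j}=p_1+\frac iN(p_2-p_1)+\frac jN(p_3-p_1)$, it consists of the $N^2$ triangles with vertices $q_{i,j},q_{i+1,j},q_{i,j+1}$ ($i,j\ge 0$, $i+j\le N-1$) or $q_{i+1,j+1},q_{i,j+1},q_{i+1,j}$ ($i,j\ge0$, $i+j\le N-2$), all of them similar to $K$ with ratio $1/N$. Let $V^L(K)=\{u\in H^2(K): u(p_i)=0,\ i=1,2,3\}$, where point values are those of the continuous representative on $K$. Let $V_h^{FM}(K)$ be the Fujino--Morley space of all piecewise functions $u_h$ such that $u_h|_T$ is a polynomial of degree at most $2$ for each $T\in\mathcal T^h$, $u_h(p_i)=0$ for $i=1,2,3$, $u_h$ is continuous at each vertex of $\mathcal T^h$, and $\int_e \frac{\partial u_h}{\partial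 n}\,ds$ takes the same value from both sides of each interior edge $e$ of $\mathcal T^h$. With $D^2u=(u_{xx},u_{xy},u_{yx},u_{yy})$ put $|u|_{2,K}^2=\int_K|D^2u|^2$ for $u\in H^2(K)$ and $|u_h|_{2,K}^2=\sum_{T\in\mathcal T^h}\int_T|D^2u_h|^2$ for $u_h\in V_h^{FM}(K)$, let $\|\cdot\|_{\infty,K}$ be the $L^\infty(K)$ norm, and define $$\lambda(K)=\inf_{0\ne u\in V^L(K)}\frac{|u|_{2,K}^2}{\|u\|_{\infty,K}^2},\qquad \lambda_h=\inf_{0\ne u_h\in V_h^{FM}(K)}\frac{|u_h|_{2,K}^2}{\|u_h\|_{\infty,K}^2}$$ (the second infimum is a minimum, since $V_h^{FM}(K)$ is finite dimensional). Then $$\lambda(K)\ \ge\ \lambda_h\left(1-\frac1{N^2}\right).$$ -/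

import Mathlib

open MeasureTheory Set
open scoped ENNReal ContDiff

noncomputable section

namespace FujinoMorley

/-- The Euclidean plane. -/
abbrev Plane : Type := EuclideanSpace ℝ (Fin 2)

/-- The classical partial derivative `∂f/∂xᵢ`. -/
def partialDeriv (i : Fin 2) (f : Plane → ℝ) (x : Plane) : ℝ :=
  fderiv ℝ f x (EuclideanSpace.single i 1)

/-! ### Weak derivatives and the Sobolev space `H²` -/

/-- `v` is a weak partial derivative `∂u/∂xᵢ` on the open set `U`. -/
def IsWeakPartial (U : Set Plane) (i : Fin 2) (u v : Plane → ℝ) : Prop :=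
  LocallyIntegrableOn v U ∧
    ∀ φ : Plane → ℝ, ContDiff ℝ ∞ φ → HasCompactSupport φ → tsupport φ ⊆ U →
      ∫ x in U, u x * partialDeriv i φ x = -∫ x in U, v x * φ x

open Classical in
/-- A chosen version of the weak partial derivative (unique almost everywhere on `U`);
zero if there is none. -/
def weakPartial (U : Set Plane) (i : Fin 2) (u : Plane → ℝ) : Plane → ℝ :=
  if hv : ∃ v, IsWeakPartial U i u v then hv.choose else 0

/-- `u ∈ H²(U)`: `u` and its weak derivatives of order one and two exist and lie in `L²(U)`. -/
def MemH2 (U : Set Plane) (u : Plane → ℝ) : Prop :=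
  MemLp u 2 (volume.restrict U) ∧
    ∃ g : Fin 2 → Plane → ℝ, ∃ H : Fin 2 → Fin 2 → Plane → ℝ,
      (∀ i, IsWeakPartial U i u (g i) ∧ MemLp (g i) 2 (volume.restrict U)) ∧
      ∀ i j, IsWeakPartial U j (g i) (H i j) ∧ MemLp (H i j) 2 (volume.restrict U)

/-- The squared seminorm `|u|²_{2,U} = ∫_U |D²u|²` with `D²u = (u_xx, u_xy, u_yx, u_yy)`. -/
def h2SeminormSq (U : Set Plane) (u : Plane → ℝ) : ℝ :=
  ∑ i, ∑ j, ∫ x in U, weakPartial U j (weakPartial U i u) x ^ 2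

/-- The `L^∞` norm on `S`. -/
def linftyNorm (S : Set Plane) (u : Plane → ℝ) : ℝ :=
  (eLpNorm u ∞ (volume.restrict S)).toReal

/-! ### Triangles and the constant `λ(K)` -/

/-- The closed triangle with the given vertices. -/
def tri (P : Fin 3 → Plane) : Set Plane := convexHull ℝ (range P)

/-- `V^L(K)`: the functions of `H²(K)` that vanish at the vertices of `K`. An element of `H²(K)`
is represented by its representative that is continuous on the closed triangle, which is what
gives its point values a meaning. -/
def VL (P : Fin 3 → Plane) : Set (Plane → ℝ) :=
  {u | MemH2 (interior (tri P)) u ∧ ContinuousOn u (tri P) ∧ ∀ i, u (P i) = 0}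

/-- `λ(K) = inf { |u|²_{2,K} / ‖u‖²_{∞,K} : u ∈ V^L(K), u ≠ 0 }`. -/
def lam (P : Fin 3 → Plane) : ℝ :=
  sInf {r | ∃ u ∈ VL P, linftyNorm (tri P) u ≠ 0 ∧
    r = h2SeminormSq (interior (tri P)) u / linftyNorm (tri P) u ^ 2}

/-! ### The Fujino–Morley space of a mesh

A mesh is a finite family `T` of triangles, and a piecewise function on it is a family of
functions, the member with index `t` being the restriction to the triangle `T t`. -/

/-- `f` is a polynomial function of total degree at most two. -/
def IsP2 (f : Plane → ℝ) : Prop :=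
  ∃ p : MvPolynomial (Fin 2) ℝ, p.totalDegree ≤ 2 ∧ ∀ x : Plane, f x = MvPolynomial.eval (fun i => x i) p

/-- The unit normal of the segment from `a` to `b` (the unit tangent turned by a right angle). -/
def unitNormal (a b : Plane) : Plane :=
  (1 / dist a b) • !₂[b 1 - a 1, -(b 0 - a 0)]

/-- `∫_e ∂f/∂n ds` for the edge `e` from `a` to `b`, parametrized proportionally to
arc length. -/
def edgeFlux (f : Plane → ℝ) (a b : Plane) : ℝ :=
  dist a b * ∫ s in (0 : ℝ)..1, fderiv ℝ f (a + s • (b - a)) (unitNormal a b)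

/-- The Fujino–Morley space `V_h^{FM}(K)`. -/
def VFM {ι : Type} (P : Fin 3 → Plane) (T : ι → Fin 3 → Plane) : Set (ι → Plane → ℝ) :=
  {u | (∀ t, IsP2 (u t)) ∧
    -- zero at the vertices of the large triangle
    (∀ t k i, T t k = P i → u t (P i) = 0) ∧
    -- continuous at every vertex of the mesh
    (∀ t s k l, T t k = T s l → u t (T t k) = u s (T t k)) ∧
    -- the integrated normal derivative agrees on both sides of every common edge
    (∀ t s k l k' l', k ≠ l → T t k = T s k' → T t l = T s l' →
      edgeFlux (u t) (T t k) (T t l) = edgeFlux (u s) (T t k) (T t l))}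

/-- The squared broken seminorm `∑_T ∫_T |D²u_h|²`. -/
def brokenSeminormSq {ι : Type} [Fintype ι] (T : ι → Fin 3 → Plane) (u : ι → Plane → ℝ) : ℝ :=
  ∑ t, ∫ x in tri (T t), ∑ i, ∑ j, partialDeriv j (partialDeriv i (u t)) x ^ 2

/-- The `L^∞(K)` norm of a piecewise function. -/
def brokenLinftyNorm {ι : Type} (T : ι → Fin 3 → Plane) (u : ι → Plane → ℝ) : ℝ :=
  (⨆ t, eLpNorm (u t) ∞ (volume.restrict (tri (T t)))).toReal

/-- `λ_h(K)`, the minimum of `|u_h|²_{2,K} / ‖u_h‖²_{∞,K}` over the nonzero elements of the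
Fujino–Morley space. -/
def lamH {ι : Type} [Fintype ι] (P : Fin 3 → Plane) (T : ι → Fin 3 → Plane) : ℝ :=
  sInf {r | ∃ u ∈ VFM P T, brokenLinftyNorm T u ≠ 0 ∧
    r = brokenSeminormSq T u / brokenLinftyNorm T u ^ 2}

/-! ### The uniform triangulation of `K_{α,θ,h}` -/

/-- The vertices `(0,0)`, `(h,0)`, `(α h cos θ, α h sin θ)` of `K_{α,θ,h}`. -/
def vertices (α θ h : ℝ) : Fin 3 → Plane :=
  ![!₂[0, 0], !₂[h, 0], !₂[α * h * Real.cos θ, α * h * Real.sin θ]]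

/-- The grid point with coordinates `i/N`, `j/N` along the two sides that meet at `P 0`. -/
def node (P : Fin 3 → Plane) (N i j : ℕ) : Plane :=
  P 0 + ((i : ℝ) / N) • (P 1 - P 0) + ((j : ℝ) / N) • (P 2 - P 0)

/-- Indices of the `N²` elements: `(i, j, false)` with `i + j < N` for the translates of `K/N`,
and `(i, j, true)` with `i + j + 1 < N` for the point reflections. -/
abbrev UniformIndex (N : ℕ) : Type :=
  {s : Fin N × Fin N × Bool //
    (s.1 : ℕ) + (s.2.1 : ℕ) + (if s.2.2 then 1 else 0) < N}

/-- The uniform triangulation with `N` subdivisions of each side. The element `(i, j, false)` has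
the vertices `(i,j)`, `(i+1,j)`, `(i,j+1)` of the grid, and `(i, j, true)` has the vertices
`(i+1,j+1)`, `(i,j+1)`, `(i+1,j)`. -/
def uniformMesh (P : Fin 3 → Plane) (N : ℕ) (s : UniformIndex N) : Fin 3 → Plane :=
  let i : ℕ := s.1.1
  let j : ℕ := s.1.2.1
  if s.1.2.2 then
    ![node P N (i + 1) (j + 1), node P N i (j + 1), node P N (i + 1) j]
  else
    ![node P N i j, node P N (i + 1) j, node P N i (j + 1)]

end FujinoMorley

end

/-! Let `H` be the symmetrized weak Hessian of `u`. On each element take the quadratic with the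
vertex values of `u` whose Hessian is the mean of `H` over that element. This is the Fujino–Morley
interpolant. Two elements with a common edge form a parallelogram, and the second difference of `u`
over it is the integral of `H`. This identity says precisely that the gradients of the two
quadratics agree at the midpoint of the edge, where the flux of a quadratic can be read off. Hence
the interpolant minus any global quadratic with the same values at the large vertices lies in the
discrete space (`interpolant_sub_mem_VFM`), and no edge traces of the gradient of `u` are needed.

Since the elementwise Hessians are means of `H`, the energy splits orthogonally into the
interpolation errors on the elements and the broken energy of the discrete function
(`energy_split`). The elements are homothetic to `K` with ratio `±1/N`, so the error on an element
pulls back to an error of the same kind on `K`, with energy multiplied by `n = 1/N²`.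

Write `a` for `lamH` and suppose each pulled-back error is at most `√(E/(a(1-n)))`, with `E` its
energy. At a point of one element, the error on `K` is at most this bound plus `√(Z/a)`, where `Z`
is the broken energy of the discrete part. By Cauchy–Schwarz with weights `n` and `1-n`
(`add_sqrt_le`) the sum is at most `√((E/n+Z)/(a(1-n)))`, and `E/n+Z` does not exceed the total
energy. So the constant `1/(a(1-n))` reproduces itself (`abs_sub_le_of_children`). After many
refinements a crude interpolation estimate starts the recursion with an arbitrarily small additive
error, which the recursion does not amplify (`abs_sub_interpolant_le`, `abs_le_sqrt_energy`).

The argument works on every nondegenerate triangle (`lamH_mul_le_lam`). The analytic input is the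
second difference identity for `H²` functions: it comes from testing the weak derivatives with a
mollified indicator of the parallelogram (`second_difference_of_weak`), and is carried to the
boundary by shrinking (`second_difference_of_interior`). -/

namespace FujinoMorley

/-! ### Affine coordinates of a triangle -/

/-- The determinant of two plane vectors. -/
def det2 (x y : Plane) : ℝ := x 0 * y 1 - x 1 * y 0

/-- A triangle is nondegenerate if two of its edge vectors are linearly independent. -/
def Nondeg (P : Fin 3 → Plane) : Prop := det2 (P 1 - P 0) (P 2 - P 0) ≠ 0

/-- The coordinate along the first edge at `P 0`. -/
noncomputable def xiCoord (P : Fin 3 → Plane) (x : Plane) : ℝ :=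
  det2 (x - P 0) (P 2 - P 0) / det2 (P 1 - P 0) (P 2 - P 0)

/-- The coordinate along the second edge at `P 0`. -/
noncomputable def etaCoord (P : Fin 3 → Plane) (x : Plane) : ℝ :=
  det2 (P 1 - P 0) (x - P 0) / det2 (P 1 - P 0) (P 2 - P 0)

/-- The point with given coordinates. -/
noncomputable def point (P : Fin 3 → Plane) (s t : ℝ) : Plane :=
  P 0 + s • (P 1 - P 0) + t • (P 2 - P 0)

theorem plane_ext {x y : Plane} (h0 : x 0 = y 0) (h1 : x 1 = y 1) : x = y := by
  ext i; fin_cases i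
  · exact h0
  · exact h1

theorem cramer {a b : Plane} (hab : det2 a b ≠ 0) (x : Plane) :
    (det2 x b / det2 a b) • a + (det2 a x / det2 a b) • b = x := by
  apply plane_ext <;>
    simp only [PiLp.add_apply, PiLp.smul_apply, smul_eq_mul] <;>
    rw [div_mul_eq_mul_div, div_mul_eq_mul_div, ← add_div, div_eq_iff hab] <;>
    unfold det2 <;> ring

theorem det2_combo_left (a b : Plane) (s t : ℝ) : det2 (s • a + t • b) b = s * det2 a b := by
  simp [det2]; ring

theorem det2_combo_right (a b : Plane) (s t : ℝ) : det2 a (s • a + t • b) = t * det2 a b := by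
  simp [det2]; ring

theorem point_coord {P : Fin 3 → Plane} (hP : Nondeg P) (x : Plane) :
    point P (xiCoord P x) (etaCoord P x) = x := by
  rw [point, add_assoc, xiCoord, etaCoord, cramer hP, add_sub_cancel]

theorem xiCoord_point {P : Fin 3 → Plane} (hP : Nondeg P) (s t : ℝ) :
    xiCoord P (point P s t) = s := by
  rw [xiCoord, point, add_assoc, add_sub_cancel_left, det2_combo_left, mul_div_cancel_right₀ _ hP]

theorem etaCoord_point {P : Fin 3 → Plane} (hP : Nondeg P) (s t : ℝ) :
    etaCoord P (point P s t) = t := by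
  rw [etaCoord, point, add_assoc, add_sub_cancel_left, det2_combo_right,
    mul_div_cancel_right₀ _ hP]

theorem point_mem_tri (P : Fin 3 → Plane) {s t : ℝ} (hs : 0 ≤ s) (ht : 0 ≤ t) (hst : s + t ≤ 1) :
    point P s t ∈ tri P := by
  have h := (convex_convexHull ℝ (range P)).sum_mem (t := Finset.univ)
    (w := ![1 - s - t, s, t]) (z := P)
    (by intro i _; fin_cases i <;> simp <;> linarith)
    (by simp [Fin.sum_univ_three]; ring)
    (fun i _ => subset_convexHull ℝ _ ⟨i, rfl⟩)
  unfold tri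
  convert h using 1
  apply plane_ext <;> simp [Fin.sum_univ_three, point] <;> ring

theorem mem_tri_iff {P : Fin 3 → Plane} (hP : Nondeg P) (x : Plane) :
    x ∈ tri P ↔ 0 ≤ xiCoord P x ∧ 0 ≤ etaCoord P x ∧ xiCoord P x + etaCoord P x ≤ 1 := by
  constructor
  · have hc : Convex ℝ {x | 0 ≤ xiCoord P x ∧ 0 ≤ etaCoord P x ∧
        xiCoord P x + etaCoord P x ≤ 1} := by
      intro x hx y hy a b ha hb hab
      have h1 : xiCoord P (a • x + b • y) = a * xiCoord P x + b * xiCoord P y := by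
        simp only [xiCoord, det2]; simp; rw [show b = 1 - a by linarith]; ring
      have h2 : etaCoord P (a • x + b • y) = a * etaCoord P x + b * etaCoord P y := by
        simp only [etaCoord, det2]; simp; rw [show b = 1 - a by linarith]; ring
      simp only [mem_ofPred_eq, h1, h2] at hx hy ⊢
      refine ⟨by nlinarith [mul_nonneg ha hx.1, mul_nonneg hb hy.1],
        by nlinarith [mul_nonneg ha hx.2.1, mul_nonneg hb hy.2.1],
        by nlinarith [mul_le_mul_of_nonneg_left hx.2.2 ha, mul_le_mul_of_nonneg_left hy.2.2 hb]⟩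
    intro hx
    refine convexHull_min ?_ hc hx
    rintro _ ⟨i, rfl⟩
    have e0 : P 0 = point P 0 0 := by simp [point]
    have e1 : P 1 = point P 1 0 := by simp [point]
    have e2 : P 2 = point P 0 1 := by simp [point]
    fin_cases i
    · change 0 ≤ xiCoord P (P 0) ∧ _
      rw [e0, xiCoord_point hP]; change _ ∧ 0 ≤ etaCoord P (P 0) ∧ xiCoord P (P 0) + etaCoord P (P 0) ≤ 1
      rw [e0, xiCoord_point hP, etaCoord_point hP]; norm_num
    · change 0 ≤ xiCoord P (P 1) ∧ _
      rw [e1, xiCoord_point hP]; change _ ∧ 0 ≤ etaCoord P (P 1) ∧ xiCoord P (P 1) + etaCoord P (P 1) ≤ 1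
      rw [e1, xiCoord_point hP, etaCoord_point hP]; norm_num
    · change 0 ≤ xiCoord P (P 2) ∧ _
      rw [e2, xiCoord_point hP]; change _ ∧ 0 ≤ etaCoord P (P 2) ∧ xiCoord P (P 2) + etaCoord P (P 2) ≤ 1
      rw [e2, xiCoord_point hP, etaCoord_point hP]; norm_num
  · rintro ⟨h1, h2, h3⟩
    rw [← point_coord hP x]
    exact point_mem_tri P h1 h2 h3

theorem convex_tri (P : Fin 3 → Plane) : Convex ℝ (tri P) := convex_convexHull ℝ _

theorem isCompact_tri (P : Fin 3 → Plane) : IsCompact (tri P) :=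
  (finite_range P).isCompact_convexHull ℝ

theorem measurableSet_tri (P : Fin 3 → Plane) : MeasurableSet (tri P) :=
  (isCompact_tri P).isClosed.measurableSet

theorem vertex_mem_tri (P : Fin 3 → Plane) (i : Fin 3) : P i ∈ tri P :=
  subset_convexHull ℝ _ ⟨i, rfl⟩

theorem continuous_xiCoord (P : Fin 3 → Plane) : Continuous (xiCoord P) := by
  unfold xiCoord det2; simp only [PiLp.sub_apply]; fun_prop

theorem continuous_etaCoord (P : Fin 3 → Plane) : Continuous (etaCoord P) := by
  unfold etaCoord det2; simp only [PiLp.sub_apply]; fun_prop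

theorem interior_tri_nonempty {P : Fin 3 → Plane} (hP : Nondeg P) :
    (interior (tri P)).Nonempty := by
  refine ⟨point P (1/4) (1/4), mem_interior.2 ⟨{x | 0 < xiCoord P x} ∩ ({x | 0 < etaCoord P x} ∩
    {x | xiCoord P x + etaCoord P x < 1}), ?_, ?_, ?_⟩⟩
  · rintro x ⟨h1, h2, h3⟩
    exact (mem_tri_iff hP x).2 ⟨le_of_lt h1, le_of_lt h2, le_of_lt h3⟩
  · exact (isOpen_lt continuous_const (continuous_xiCoord P)).inter
      ((isOpen_lt continuous_const (continuous_etaCoord P)).inter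
      (isOpen_lt ((continuous_xiCoord P).add (continuous_etaCoord P)) continuous_const))
  · simp only [mem_inter_iff, mem_ofPred_eq, xiCoord_point hP, etaCoord_point hP]; norm_num

theorem closure_interior_tri {P : Fin 3 → Plane} (hP : Nondeg P) :
    closure (interior (tri P)) = tri P := by
  rw [(convex_tri P).closure_interior_eq_closure_of_nonempty_interior (interior_tri_nonempty hP),
    (isCompact_tri P).isClosed.closure_eq]

theorem interior_ae_eq_of_convex {S : Set Plane} (hS : Convex ℝ S) :
    interior S =ᵐ[volume] S :=
  interior_ae_eq_of_null_frontier (hS.addHaar_frontier volume)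

theorem volume_tri_pos {P : Fin 3 → Plane} (hP : Nondeg P) : 0 < volume.real (tri P) := by
  rw [Measure.real, ENNReal.toReal_pos_iff]
  exact ⟨Measure.measure_pos_of_nonempty_interior _ (interior_tri_nonempty hP),
    (isCompact_tri P).measure_lt_top⟩

/-! ### Homotheties -/

/-- The homothety of ratio `r` that sends `o` to `n`. -/
def homot (o n : Plane) (r : ℝ) (x : Plane) : Plane := n + r • (x - o)

theorem homot_injective (o n : Plane) {r : ℝ} (hr : r ≠ 0) : Function.Injective (homot o n r) := by
  intro x y h
  have h' : r • (x - o) = r • (y - o) := add_left_cancel h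
  have := smul_right_injective Plane hr h'
  exact sub_left_injective this

theorem continuous_homot (o n : Plane) (r : ℝ) : Continuous (homot o n r) := by
  unfold homot; fun_prop

theorem hasFDerivAt_homot (o n : Plane) (r : ℝ) (x : Plane) :
    HasFDerivAt (homot o n r) (r • ContinuousLinearMap.id ℝ Plane) x := by
  unfold homot
  exact (((hasFDerivAt_id x).sub_const o).const_smul r).const_add n

theorem abs_det_smul_id (r : ℝ) : |(r • ContinuousLinearMap.id ℝ Plane).det| = r ^ 2 := by
  have : (r • ContinuousLinearMap.id ℝ Plane).det = r ^ 2 := by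
    rw [ContinuousLinearMap.det, ContinuousLinearMap.toLinearMap_smul, LinearMap.det_smul]
    simp
  rw [this, abs_of_nonneg (sq_nonneg r)]

theorem setIntegral_image_homot (o n : Plane) {r : ℝ} (hr : r ≠ 0) {S : Set Plane}
    (hS : MeasurableSet S) (f : Plane → ℝ) :
    ∫ x in homot o n r '' S, f x = r ^ 2 * ∫ x in S, f (homot o n r x) := by
  rw [integral_image_eq_integral_abs_det_fderiv_smul volume hS
    (fun x _ => (hasFDerivAt_homot o n r x).hasFDerivWithinAt) (homot_injective o n hr).injOn]
  simp only [abs_det_smul_id, smul_eq_mul, integral_const_mul]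

theorem integrableOn_image_homot (o n : Plane) {r : ℝ} (hr : r ≠ 0) {S : Set Plane}
    (hS : MeasurableSet S) (f : Plane → ℝ) :
    IntegrableOn f (homot o n r '' S) ↔ IntegrableOn (fun x => f (homot o n r x)) S := by
  rw [integrableOn_image_iff_integrableOn_abs_det_fderiv_smul volume hS
    (fun x _ => (hasFDerivAt_homot o n r x).hasFDerivWithinAt) (homot_injective o n hr).injOn]
  simp only [abs_det_smul_id, smul_eq_mul]
  exact integrable_const_mul_iff (isUnit_iff_ne_zero.2 (pow_ne_zero 2 hr)) _

theorem volume_image_homot (o n : Plane) {r : ℝ} (hr : r ≠ 0) {S : Set Plane}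
    (hS : MeasurableSet S) :
    volume.real (homot o n r '' S) = r ^ 2 * volume.real S := by
  have := setIntegral_image_homot o n hr hS (fun _ => 1)
  simpa using this

theorem homot_combo (o n : Plane) (r : ℝ) (P : Fin 3 → Plane) (s t : ℝ) :
    homot o n r (point P s t) = point (fun k => homot o n r (P k)) s t := by
  apply plane_ext <;> simp [homot, point] <;> ring

theorem nondeg_homot (o n : Plane) {r : ℝ} (hr : r ≠ 0) {P : Fin 3 → Plane} (hP : Nondeg P) :
    Nondeg (fun k => homot o n r (P k)) := by
  have : det2 (homot o n r (P 1) - homot o n r (P 0)) (homot o n r (P 2) - homot o n r (P 0)) =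
      r ^ 2 * det2 (P 1 - P 0) (P 2 - P 0) := by
    simp [homot, det2]; ring
  unfold Nondeg; rw [this]; exact mul_ne_zero (pow_ne_zero 2 hr) hP

theorem tri_homot (o n : Plane) {r : ℝ} (hr : r ≠ 0) {P : Fin 3 → Plane} (hP : Nondeg P) :
    tri (fun k => homot o n r (P k)) = homot o n r '' tri P := by
  have hP' := nondeg_homot o n hr hP
  ext x
  constructor
  · intro hx
    rw [← point_coord hP' x, ← homot_combo]
    have := (mem_tri_iff hP' x).1 hx
    exact ⟨_, point_mem_tri P this.1 this.2.1 this.2.2, rfl⟩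
  · rintro ⟨y, hy, rfl⟩
    rw [← point_coord hP y, homot_combo]
    have := (mem_tri_iff hP y).1 hy
    exact point_mem_tri _ this.1 this.2.1 this.2.2

/-! ### Parallelograms -/

/-- The closed parallelogram with corner `c` and edge vectors `a`, `b`. -/
def para (c a b : Plane) : Set Plane :=
  {x | ∃ s ∈ Icc (0:ℝ) 1, ∃ t ∈ Icc (0:ℝ) 1, x = c + s • a + t • b}

theorem para_eq_image (c a b : Plane) :
    para c a b = (fun p : ℝ × ℝ => c + p.1 • a + p.2 • b) '' (Icc 0 1 ×ˢ Icc 0 1) := by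
  ext x; constructor
  · rintro ⟨s, hs, t, ht, rfl⟩; exact ⟨(s, t), ⟨hs, ht⟩, rfl⟩
  · rintro ⟨⟨s, t⟩, ⟨hs, ht⟩, rfl⟩; exact ⟨s, hs, t, ht, rfl⟩

theorem isCompact_para (c a b : Plane) : IsCompact (para c a b) := by
  rw [para_eq_image]
  exact (isCompact_Icc.prod isCompact_Icc).image (by fun_prop)

theorem convex_para (c a b : Plane) : Convex ℝ (para c a b) := by
  rintro _ ⟨s, hs, t, ht, rfl⟩ _ ⟨s', hs', t', ht', rfl⟩ p q hp hq hpq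
  refine ⟨p * s + q * s', convex_Icc 0 1 hs hs' hp hq hpq, p * t + q * t',
    convex_Icc 0 1 ht ht' hp hq hpq, ?_⟩
  obtain rfl : q = 1 - p := by linarith
  apply plane_ext <;> simp <;> ring

theorem homot_image_para (o n : Plane) (r : ℝ) (c a b : Plane) :
    homot o n r '' para c a b = para (homot o n r c) (r • a) (r • b) := by
  ext x; constructor
  · rintro ⟨_, ⟨s, hs, t, ht, rfl⟩, rfl⟩
    exact ⟨s, hs, t, ht, by apply plane_ext <;> simp [homot] <;> ring⟩
  · rintro ⟨s, hs, t, ht, rfl⟩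
    exact ⟨_, ⟨s, hs, t, ht, rfl⟩, by apply plane_ext <;> simp [homot] <;> ring⟩

theorem det2_smul_smul (r : ℝ) (a b : Plane) : det2 (r • a) (r • b) = r ^ 2 * det2 a b := by
  simp [det2]; ring

/-- Written with the area of the parallelogram as factor, so that no determinant has to be
identified with an area. -/
theorem integral_para {c a b : Plane} (hab : det2 a b ≠ 0) {f : Plane → ℝ} (hf : Continuous f) :
    ∫ x in para c a b, f x =
      volume.real (para c a b) * ∫ s in (0:ℝ)..1, ∫ t in (0:ℝ)..1, f (c + s • a + t • b) := by
  let L : (ℝ × ℝ) ≃ₗ[ℝ] Plane :=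
    { toFun := fun p => p.1 • a + p.2 • b
      invFun := fun x => (det2 x b / det2 a b, det2 a x / det2 a b)
      map_add' := by intro p q; apply plane_ext <;> simp <;> ring
      map_smul' := by intro p q; apply plane_ext <;> simp <;> ring
      left_inv := by
        intro p
        simp only [det2_combo_left, det2_combo_right, mul_div_cancel_right₀ _ hab]
      right_inv := fun x => cramer hab x }
  let M : (ℝ × ℝ) ≃L[ℝ] Plane := L.toContinuousLinearEquiv
  have hM : ∀ p : ℝ × ℝ, M p = p.1 • a + p.2 • b := fun p => rfl
  -- Uniqueness of Haar measure gives the change of variables up to an unknown factor `κ`; the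
  -- integrand `1` identifies `κ` with the area.
  obtain ⟨κ, hκ⟩ : ∃ κ : NNReal, (volume : Measure Plane) = κ • (volume : Measure (ℝ × ℝ)).map M :=
    ⟨_, Measure.isAddLeftInvariant_eq_smul _ _⟩
  have himg : para c a b = (fun x => c + x) '' (M '' (Icc 0 1 ×ˢ Icc 0 1)) := by
    rw [para_eq_image, image_image]; simp only [hM, add_assoc]
  have key : ∀ g : Plane → ℝ, Continuous g → ∫ x in para c a b, g x =
      κ * ∫ s in (0:ℝ)..1, ∫ t in (0:ℝ)..1, g (c + s • a + t • b) := by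
    intro g hg
    have h1 : ∫ x in para c a b, g x = ∫ x in M '' (Icc 0 1 ×ˢ Icc 0 1), g (c + x) := by
      rw [himg]
      exact (measurePreserving_add_left (volume : Measure Plane) c).setIntegral_image_emb
        (MeasurableEquiv.addLeft c).measurableEmbedding g _
    rw [h1, hκ, Measure.restrict_smul, integral_smul_nnreal_measure, NNReal.smul_def, smul_eq_mul]
    congr 1
    have hme : MeasurableEmbedding M := M.toHomeomorph.measurableEmbedding
    rw [hme.setIntegral_map, preimage_image_eq _ M.injective, Measure.volume_eq_prod,
      setIntegral_prod]
    · simp only [hM, intervalIntegral.integral_of_le zero_le_one, integral_Icc_eq_integral_Ioc,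
        add_assoc]
    · exact (Continuous.continuousOn (by fun_prop)).integrableOn_compact
        (isCompact_Icc.prod isCompact_Icc)
  have h1 := key (fun _ => 1) continuous_const
  simp at h1
  rw [key f hf, h1]

end FujinoMorley

/-! ### Geometry of the uniform mesh -/

namespace FujinoMorley

/-! ### The elements of the uniform mesh as homothetic images -/

/-- The signed ratio of the homothety that sends the large triangle to an element. -/
noncomputable def meshRatio (N : ℕ) (s : UniformIndex N) : ℝ := if s.1.2.2 then -(1 / N) else 1 / N

/-- The homothety that sends the large triangle to an element. -/
noncomputable def meshMap (P : Fin 3 → Plane) (N : ℕ) (s : UniformIndex N) : Plane → Plane :=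
  homot (P 0) (uniformMesh P N s 0) (meshRatio N s)

theorem meshMap_vertex (P : Fin 3 → Plane) (N : ℕ) (s : UniformIndex N) (k : Fin 3) :
    meshMap P N s (P k) = uniformMesh P N s k := by
  obtain ⟨⟨i, j, b⟩, hs⟩ := s
  cases b <;> fin_cases k <;> apply plane_ext <;>
    simp [meshMap, homot, uniformMesh, meshRatio, node] <;> ring

theorem meshRatio_ne_zero {N : ℕ} (hN : 1 ≤ N) (s : UniformIndex N) : meshRatio N s ≠ 0 := by
  have : (N : ℝ) ≠ 0 := by positivity
  unfold meshRatio; split_ifs <;> simp [this]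

theorem meshRatio_sq (N : ℕ) (s : UniformIndex N) : meshRatio N s ^ 2 = (1 / (N : ℝ)) ^ 2 := by
  unfold meshRatio; split_ifs <;> ring

theorem abs_meshRatio (N : ℕ) (s : UniformIndex N) : |meshRatio N s| = 1 / (N : ℝ) := by
  have : (0 : ℝ) ≤ 1 / N := by positivity
  unfold meshRatio; split_ifs
  · rw [abs_neg, abs_of_nonneg this]
  · rw [abs_of_nonneg this]

theorem uniformMesh_eq (P : Fin 3 → Plane) (N : ℕ) (s : UniformIndex N) :
    uniformMesh P N s = fun k => meshMap P N s (P k) := by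
  funext k; rw [meshMap_vertex]

theorem tri_uniformMesh {P : Fin 3 → Plane} (hP : Nondeg P) {N : ℕ} (hN : 1 ≤ N)
    (s : UniformIndex N) : tri (uniformMesh P N s) = meshMap P N s '' tri P := by
  rw [uniformMesh_eq]
  exact tri_homot _ _ (meshRatio_ne_zero hN s) hP

theorem meshMap_point (P : Fin 3 → Plane) (N : ℕ) (s : UniformIndex N) (x y : ℝ) :
    meshMap P N s (point P x y) =
      point P (((s.1.1 : ℕ) + if s.1.2.2 then 1 - x else x) / N)
        (((s.1.2.1 : ℕ) + if s.1.2.2 then 1 - y else y) / N) := by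
  obtain ⟨⟨i, j, b⟩, hs⟩ := s
  cases b <;> apply plane_ext <;>
    simp [meshMap, homot, uniformMesh, meshRatio, node, point] <;> ring

theorem meshMap_mem {P : Fin 3 → Plane} (hP : Nondeg P) {N : ℕ} (hN : 1 ≤ N)
    (s : UniformIndex N) {x : Plane} (hx : x ∈ tri P) : meshMap P N s x ∈ tri P := by
  have hN' : (0 : ℝ) < N := by positivity
  obtain ⟨h1, h2, h3⟩ := (mem_tri_iff hP x).1 hx
  rw [← point_coord hP x, meshMap_point]
  obtain ⟨⟨i, j, b⟩, hs⟩ := s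
  have hi : (0 : ℝ) ≤ (i : ℕ) := Nat.cast_nonneg _
  have hj : (0 : ℝ) ≤ (j : ℕ) := Nat.cast_nonneg _
  cases b
  · have hs' : ((i : ℕ) : ℝ) + (j : ℕ) + 1 ≤ N := by
      have : (i : ℕ) + j + 1 ≤ N := by simpa using hs
      exact_mod_cast this
    apply point_mem_tri
    · simp; positivity
    · simp; positivity
    · simp; rw [← add_div, div_le_one hN']; linarith
  · have hs' : ((i : ℕ) : ℝ) + (j : ℕ) + 2 ≤ N := by
      have : (i : ℕ) + j + 2 ≤ N := by simp at hs; omega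
      exact_mod_cast this
    apply point_mem_tri
    · simp; apply div_nonneg _ hN'.le; linarith
    · simp; apply div_nonneg _ hN'.le; linarith
    · simp; rw [← add_div, div_le_one hN']; linarith

theorem tri_uniformMesh_subset {P : Fin 3 → Plane} (hP : Nondeg P) {N : ℕ} (hN : 1 ≤ N)
    (s : UniformIndex N) : tri (uniformMesh P N s) ⊆ tri P := by
  rw [tri_uniformMesh hP hN]
  rintro _ ⟨x, hx, rfl⟩
  exact meshMap_mem hP hN s hx

theorem exists_meshMap_eq {P : Fin 3 → Plane} (hP : Nondeg P) {N : ℕ} (hN : 1 ≤ N)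
    {x : Plane} (hx : x ∈ tri P) : ∃ s : UniformIndex N, ∃ y ∈ tri P, meshMap P N s y = x := by
  have hN' : (0 : ℝ) < N := by positivity
  obtain ⟨h1, h2, h3⟩ := (mem_tri_iff hP x).1 hx
  set a := (N : ℝ) * xiCoord P x with ha
  set b := (N : ℝ) * etaCoord P x with hb
  have ha0 : 0 ≤ a := by positivity
  have hb0 : 0 ≤ b := by positivity
  have hab : a + b ≤ N := by
    rw [ha, hb, ← mul_add]; exact mul_le_of_le_one_right hN'.le h3
  have ea : a / N = xiCoord P x := by rw [ha]; field_simp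
  have eb : b / N = etaCoord P x := by rw [hb]; field_simp
  have hfa := Nat.floor_le ha0
  have hfb := Nat.floor_le hb0
  have hla := Nat.lt_floor_add_one a
  have hlb := Nat.lt_floor_add_one b
  set i := ⌊a⌋₊
  set j := ⌊b⌋₊
  have hij : i + j ≤ N := by
    have : (i : ℝ) + j ≤ N := by linarith
    exact_mod_cast this
  rw [← point_coord hP x, ← ea, ← eb]
  rcases hij.lt_or_eq with hlt | heq
  · by_cases hc : (a - i) + (b - j) ≤ 1
    · refine ⟨⟨(⟨i, by omega⟩, ⟨j, by omega⟩, false), by simpa using hlt⟩, point P (a - i) (b - j),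
        point_mem_tri P (by linarith) (by linarith) hc, ?_⟩
      rw [meshMap_point]; simp
    · have hlt2 : i + j + 1 < N := by
        have : (i : ℝ) + j + 1 < N := by linarith
        exact_mod_cast this
      refine ⟨⟨(⟨i, by omega⟩, ⟨j, by omega⟩, true), by simpa using hlt2⟩,
        point P (1 - (a - i)) (1 - (b - j)),
        point_mem_tri P (by linarith) (by linarith) (by linarith), ?_⟩
      rw [meshMap_point]; simp
  -- Here `x` is a grid point on the side opposite `P 0`, and the floors name a cell outside `K`. An
  -- adjacent element inside `K` has `x` as its vertex `2` (if `i = 0`) or `1`.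
  · have heq' : (i : ℝ) + j = N := by exact_mod_cast heq
    have ha' : a = i := by linarith
    have hb' : b = j := by linarith
    rcases Nat.eq_zero_or_pos i with hi | hi
    · refine ⟨⟨(⟨0, by omega⟩, ⟨j - 1, by omega⟩, false), by simp; omega⟩, point P 0 1,
        point_mem_tri P le_rfl zero_le_one (by norm_num), ?_⟩
      rw [meshMap_point, ha', hb', hi]
      have : ((j - 1 : ℕ) : ℝ) + 1 = j := by
        have : j - 1 + 1 = j := by omega
        exact_mod_cast this
      simp [this]
    · refine ⟨⟨(⟨i - 1, by omega⟩, ⟨j, by omega⟩, false), by simp; omega⟩, point P 1 0,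
        point_mem_tri P zero_le_one le_rfl (by norm_num), ?_⟩
      rw [meshMap_point, ha', hb']
      have : ((i - 1 : ℕ) : ℝ) + 1 = i := by
        have : i - 1 + 1 = i := by omega
        exact_mod_cast this
      simp [this]

theorem iUnion_tri_uniformMesh {P : Fin 3 → Plane} (hP : Nondeg P) {N : ℕ} (hN : 1 ≤ N) :
    ⋃ s, tri (uniformMesh P N s) = tri P := by
  apply subset_antisymm
  · exact iUnion_subset fun s => tri_uniformMesh_subset hP hN s
  · intro x hx
    obtain ⟨s, y, hy, rfl⟩ := exists_meshMap_eq hP hN hx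
    rw [mem_iUnion]
    exact ⟨s, by rw [tri_uniformMesh hP hN]; exact mem_image_of_mem _ hy⟩

/-! ### The elements of the mesh overlap in null sets only -/

theorem volume_line_eq_zero {α β : ℝ} (h : α ≠ 0 ∨ β ≠ 0) (γ : ℝ) :
    volume {x : Plane | α * x 0 + β * x 1 = γ} = 0 := by
  let S : AffineSubspace ℝ Plane :=
    { carrier := {x : Plane | α * x 0 + β * x 1 = γ}
      smul_vsub_vadd_mem' := by
        intro c p q r hp hq hr
        simp only [mem_ofPred_eq] at hp hq hr ⊢
        simp only [vsub_eq_sub, vadd_eq_add, PiLp.add_apply, PiLp.smul_apply, PiLp.sub_apply,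
          smul_eq_mul]
        linear_combination c * hp - c * hq + hr }
  refine Measure.addHaar_affineSubspace volume S fun hS => ?_
  have h1 : ∀ x : Plane, α * x 0 + β * x 1 = γ := fun x => by
    have : x ∈ S := by rw [hS]; trivial
    exact this
  have e0 := h1 0
  have e1 := h1 !₂[1, 0]
  have e2 := h1 !₂[0, 1]
  simp at e0 e1 e2
  rw [← e0] at e1 e2
  tauto

theorem volume_coord_eq_zero {P : Fin 3 → Plane} (hP : Nondeg P) {m n : ℝ} (hmn : m ≠ 0 ∨ n ≠ 0)
    (γ : ℝ) : volume {x : Plane | m * xiCoord P x + n * etaCoord P x = γ} = 0 := by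
  set a := P 1 - P 0 with ha
  set b := P 2 - P 0 with hb
  set D := det2 a b with hD
  have hD0 : D ≠ 0 := hP
  have key : {x : Plane | m * xiCoord P x + n * etaCoord P x = γ} =
      {x : Plane | (m * b 1 - n * a 1) * x 0 + (n * a 0 - m * b 0) * x 1 =
        γ * D + (m * b 1 - n * a 1) * P 0 0 + (n * a 0 - m * b 0) * P 0 1} := by
    ext x
    simp only [mem_ofPred_eq, xiCoord, etaCoord, ← ha, ← hb, ← hD]
    rw [mul_div_assoc', mul_div_assoc', ← add_div, div_eq_iff hD0]
    simp only [det2, PiLp.sub_apply]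
    constructor <;> intro h <;> linear_combination h
  rw [key]
  apply volume_line_eq_zero
  by_contra hcon
  push Not at hcon
  -- Pairing the normal of the line with the edge vectors `a` and `b` recovers `m * D` and `n * D`.
  have hm : m * D = 0 := by
    simp only [hD, det2]; linear_combination a 0 * hcon.1 + a 1 * hcon.2
  have hn : n * D = 0 := by
    simp only [hD, det2]; linear_combination b 0 * hcon.1 + b 1 * hcon.2
  rcases hmn with h | h
  · exact h ((mul_eq_zero.1 hm).resolve_right hD0)
  · exact h ((mul_eq_zero.1 hn).resolve_right hD0)

theorem coords_of_mem_uniformMesh {P : Fin 3 → Plane} (hP : Nondeg P) {N : ℕ} (hN : 1 ≤ N)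
    {s : UniformIndex N} {x : Plane} (hx : x ∈ tri (uniformMesh P N s)) :
    ((s.1.1 : ℕ) : ℝ) ≤ N * xiCoord P x ∧ N * xiCoord P x ≤ (s.1.1 : ℕ) + 1 ∧
    ((s.1.2.1 : ℕ) : ℝ) ≤ N * etaCoord P x ∧ N * etaCoord P x ≤ (s.1.2.1 : ℕ) + 1 ∧
    (s.1.2.2 = false → N * xiCoord P x + N * etaCoord P x ≤ (s.1.1 : ℕ) + (s.1.2.1 : ℕ) + 1) ∧
    (s.1.2.2 = true → (s.1.1 : ℕ) + (s.1.2.1 : ℕ) + 1 ≤ N * xiCoord P x + N * etaCoord P x) := by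
  have hN' : (N : ℝ) ≠ 0 := by positivity
  rw [tri_uniformMesh hP hN] at hx
  obtain ⟨y, hy, rfl⟩ := hx
  obtain ⟨h1, h2, h3⟩ := (mem_tri_iff hP y).1 hy
  rw [← point_coord hP y, meshMap_point, xiCoord_point hP, etaCoord_point hP,
    mul_div_cancel₀ _ hN', mul_div_cancel₀ _ hN']
  split_ifs with hb
  · simp only [hb]
    refine ⟨by linarith, by linarith, by linarith, by linarith, by simp, fun _ => by linarith⟩
  · simp only [hb]
    refine ⟨by linarith, by linarith, by linarith, by linarith, fun _ => by linarith, by simp⟩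

theorem aedisjoint_uniformMesh {P : Fin 3 → Plane} (hP : Nondeg P) {N : ℕ} (hN : 1 ≤ N) :
    Pairwise (Function.onFun (AEDisjoint volume) fun s => tri (uniformMesh P N s)) := by
  have hN' : (N : ℝ) ≠ 0 := by positivity
  -- Off the countably many grid lines of the three directions, the element containing a point is
  -- determined.
  have hZ : volume (⋃ m : ℤ, ({x : Plane | N * xiCoord P x + 0 * etaCoord P x = m} ∪
      {x : Plane | 0 * xiCoord P x + N * etaCoord P x = m}) ∪
      {x : Plane | N * xiCoord P x + N * etaCoord P x = m}) = 0 := by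
    rw [measure_iUnion_null_iff]
    intro m
    rw [measure_union_null_iff, measure_union_null_iff]
    exact ⟨⟨volume_coord_eq_zero hP (.inl hN') m, volume_coord_eq_zero hP (.inr hN') m⟩,
      volume_coord_eq_zero hP (.inl hN') m⟩
  intro s t hst
  refine measure_mono_null ?_ hZ
  rintro x ⟨hxs, hxt⟩
  by_contra hx
  simp only [mem_iUnion, mem_union, mem_ofPred_eq, zero_mul, add_zero, zero_add, not_exists,
    not_or] at hx
  obtain ⟨a1, a2, a3, a4, a5, a6⟩ := coords_of_mem_uniformMesh hP hN hxs
  obtain ⟨b1, b2, b3, b4, b5, b6⟩ := coords_of_mem_uniformMesh hP hN hxt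
  obtain ⟨⟨i, j, b⟩, hs⟩ := s
  obtain ⟨⟨i', j', b'⟩, ht⟩ := t
  simp only at a1 a2 a3 a4 a5 a6 b1 b2 b3 b4 b5 b6
  -- A non-integer lies in only one of the closed unit intervals with integer endpoints.
  have flo : ∀ {n n' : ℕ} {z : ℝ}, (∀ m : ℤ, z ≠ m) → (n : ℝ) ≤ z → z ≤ n + 1 → (n' : ℝ) ≤ z →
      z ≤ n' + 1 → n = n' := by
    intro n n' z hz h1 h2 h3 h4
    have h2' := lt_of_le_of_ne h2 (by simpa using hz (n + 1))
    have h4' := lt_of_le_of_ne h4 (by simpa using hz (n' + 1))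
    have e1 : (n : ℝ) < n' + 1 := by linarith
    have e2 : (n' : ℝ) < n + 1 := by linarith
    have e1' : n < n' + 1 := by exact_mod_cast e1
    have e2' : n' < n + 1 := by exact_mod_cast e2
    omega
  have hi : i = i' := Fin.ext (flo (fun m => (hx m).1.1) a1 a2 b1 b2)
  have hj : j = j' := Fin.ext (flo (fun m => (hx m).1.2) a3 a4 b3 b4)
  subst hi hj
  have hd := (hx ((i : ℕ) + (j : ℕ) + 1)).2
  push_cast at hd
  cases b <;> cases b' <;> simp at hst a5 a6 b5 b6
  · exact hd (le_antisymm a5 b6)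
  · exact hd (le_antisymm b5 a6)

theorem sum_setIntegral_uniformMesh {P : Fin 3 → Plane} (hP : Nondeg P) {N : ℕ} (hN : 1 ≤ N)
    {f : Plane → ℝ} (hf : IntegrableOn f (tri P)) :
    ∑ s, ∫ x in tri (uniformMesh P N s), f x = ∫ x in tri P, f x := by
  rw [← iUnion_tri_uniformMesh hP hN] at hf ⊢
  rw [integral_iUnion_ae (fun s => (measurableSet_tri _).nullMeasurableSet)
    (aedisjoint_uniformMesh hP hN) hf, tsum_fintype]

/-! ### Elements with a common edge -/

/-- The coordinates of the vertices of the large triangle. -/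
def vertexCoord : Fin 3 → ℤ × ℤ := ![(0, 0), (1, 0), (0, 1)]

theorem vertex_eq_point (P : Fin 3 → Plane) (k : Fin 3) :
    P k = point P (vertexCoord k).1 (vertexCoord k).2 := by
  fin_cases k <;> simp [vertexCoord, point]

theorem point_sub (P : Fin 3 → Plane) (a b c d : ℝ) :
    point P a b - point P c d = (a - c) • (P 1 - P 0) + (b - d) • (P 2 - P 0) := by
  apply plane_ext <;> simp [point] <;> ring

theorem combo_injective {a b : Plane} (hab : det2 a b ≠ 0) {s t s' t' : ℝ}
    (h : s • a + t • b = s' • a + t' • b) : s = s' ∧ t = t' := by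
  constructor
  · have := congrArg (fun z => det2 z b) h
    simp only [det2_combo_left] at this
    exact mul_right_cancel₀ hab this
  · have := congrArg (fun z => det2 a z) h
    simp only [det2_combo_right] at this
    exact mul_right_cancel₀ hab this

/-- In affine coordinates the six oriented edges are `±(1,0)`, `±(0,1)`, `±(1,-1)`, which are
pairwise distinct. -/
theorem edge_eq_of_sub_eq {P : Fin 3 → Plane} (hP : Nondeg P) {k l k' l' : Fin 3} (hkl : k ≠ l)
    (h : P k - P l = P k' - P l') : k = k' ∧ l = l' := by
  rw [vertex_eq_point P k, vertex_eq_point P l, vertex_eq_point P k', vertex_eq_point P l',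
    point_sub, point_sub] at h
  obtain ⟨h1, h2⟩ := combo_injective hP h
  norm_cast at h1 h2
  have : ∀ k l k' l' : Fin 3, k ≠ l → (vertexCoord k).1 - (vertexCoord l).1 =
      (vertexCoord k').1 - (vertexCoord l').1 → (vertexCoord k).2 - (vertexCoord l).2 =
      (vertexCoord k').2 - (vertexCoord l').2 → k = k' ∧ l = l' := by decide
  exact this k l k' l' hkl h1 h2

theorem uniformMesh_sub (P : Fin 3 → Plane) (N : ℕ) (s : UniformIndex N) (k l : Fin 3) :
    uniformMesh P N s k - uniformMesh P N s l = meshRatio N s • (P k - P l) := by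
  rw [← meshMap_vertex, ← meshMap_vertex]
  apply plane_ext <;> simp [meshMap, homot] <;> ring

theorem uniformMesh_zero_injective {P : Fin 3 → Plane} (hP : Nondeg P) {N : ℕ} (hN : 1 ≤ N)
    {s t : UniformIndex N} (hb : s.1.2.2 = t.1.2.2)
    (h : uniformMesh P N s 0 = uniformMesh P N t 0) : s = t := by
  have hN' : (N : ℝ) ≠ 0 := by positivity
  rw [← meshMap_vertex, ← meshMap_vertex, vertex_eq_point P 0, meshMap_point, meshMap_point] at h
  have h1 := congrArg (xiCoord P) h
  have h2 := congrArg (etaCoord P) h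
  rw [xiCoord_point hP, xiCoord_point hP, div_left_inj' hN'] at h1
  rw [etaCoord_point hP, etaCoord_point hP, div_left_inj' hN'] at h2
  obtain ⟨⟨i, j, b⟩, hs⟩ := s
  obtain ⟨⟨i', j', b'⟩, ht⟩ := t
  simp only at hb
  subst hb
  simp only [add_left_inj, Nat.cast_inj] at h1 h2
  have := Fin.ext h1
  have := Fin.ext h2
  subst_vars; rfl

/-- Two elements with a common edge are reflections of each other in its midpoint. -/
theorem neighbour {P : Fin 3 → Plane} (hP : Nondeg P) {N : ℕ} (hN : 1 ≤ N)
    {s t : UniformIndex N} (hst : s ≠ t) {k l k' l' : Fin 3} (hkl : k ≠ l)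
    (hk : uniformMesh P N s k = uniformMesh P N t k')
    (hl : uniformMesh P N s l = uniformMesh P N t l') :
    meshRatio N t = -meshRatio N s ∧ ∀ m, uniformMesh P N s m + uniformMesh P N t m =
      uniformMesh P N s k + uniformMesh P N s l := by
  have hd : meshRatio N s • (P k - P l) = meshRatio N t • (P k' - P l') := by
    rw [← uniformMesh_sub, ← uniformMesh_sub, hk, hl]
  have hr := meshRatio_ne_zero hN s
  by_cases hb : s.1.2.2 = t.1.2.2
  · exfalso
    -- Elements of equal orientation are translates, so a common edge would have the same labels in
    -- both and the elements would coincide.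
    have e : meshRatio N s = meshRatio N t := by simp [meshRatio, hb]
    rw [← e] at hd
    obtain ⟨rfl, rfl⟩ := edge_eq_of_sub_eq hP hkl (smul_right_injective Plane hr hd)
    apply hst (uniformMesh_zero_injective hP hN hb _)
    have h1 := uniformMesh_sub P N s k 0
    have h2 := uniformMesh_sub P N t k 0
    rw [← e, ← h1, hk] at h2
    exact (sub_right_injective h2).symm
  · have e : meshRatio N t = -meshRatio N s := by
      unfold meshRatio
      cases hs : s.1.2.2 <;> cases ht : t.1.2.2 <;> simp_all
    -- With opposite orientations the edge vector is reversed, which forces `k' = l` and `l' = k`.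
    rw [e, neg_smul, ← smul_neg, neg_sub] at hd
    obtain ⟨rfl, rfl⟩ := edge_eq_of_sub_eq hP hkl (smul_right_injective Plane hr hd)
    refine ⟨e, fun m => ?_⟩
    have h1 := uniformMesh_sub P N s m k
    have h2 := uniformMesh_sub P N t m k
    rw [e, neg_smul, ← h1] at h2
    rw [hl, ← sub_eq_zero, ← sub_eq_zero.2 h2]
    abel

end FujinoMorley

/-! ### Quadratics, second differences and the interpolant -/

namespace FujinoMorley

/-! ### Quadratic functions -/

/-- The bilinear form with coefficient matrix `S`. -/
def bil (S : Fin 2 → Fin 2 → ℝ) (x y : Plane) : ℝ :=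
  S 0 0 * x 0 * y 0 + S 0 1 * x 0 * y 1 + S 1 0 * x 1 * y 0 + S 1 1 * x 1 * y 1

/-- `f` is a polynomial function of degree at most two with Hessian `S`. -/
def IsQuad (f : Plane → ℝ) (S : Fin 2 → Fin 2 → ℝ) : Prop :=
  S 0 1 = S 1 0 ∧ ∃ c l m : ℝ, ∀ x : Plane, f x = c + l * x 0 + m * x 1 + bil S x x / 2

theorem bil_sub (S T : Fin 2 → Fin 2 → ℝ) (x y : Plane) :
    bil (fun i j => S i j - T i j) x y = bil S x y - bil T x y := by
  simp only [bil]; ring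

theorem isQuad_zero : IsQuad (fun _ => 0) (fun _ _ => 0) :=
  ⟨rfl, 0, 0, 0, fun x => by simp [bil]⟩

namespace IsQuad

variable {f g : Plane → ℝ} {S T : Fin 2 → Fin 2 → ℝ}

theorem sub (hf : IsQuad f S) (hg : IsQuad g T) :
    IsQuad (fun x => f x - g x) (fun i j => S i j - T i j) := by
  obtain ⟨hS, c, l, m, h⟩ := hf
  obtain ⟨hT, c', l', m', h'⟩ := hg
  exact ⟨by simp only [hS, hT], c - c', l - l', m - m',
    fun x => by simp only [h, h', bil_sub]; ring⟩

theorem comp_homot (hf : IsQuad f S) (o n : Plane) (r : ℝ) :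
    IsQuad (fun x => f (homot o n r x)) (fun i j => r ^ 2 * S i j) := by
  obtain ⟨hS, c, l, m, h⟩ := hf
  refine ⟨by simp only [hS], c + l * (n - r • o) 0 + m * (n - r • o) 1 +
    bil S (n - r • o) (n - r • o) / 2, r * (l + bil S (n - r • o) (EuclideanSpace.single 0 1)),
    r * (m + bil S (n - r • o) (EuclideanSpace.single 1 1)), fun x => ?_⟩
  simp only [h]
  simp [bil, homot, hS]
  ring

theorem isP2 (hf : IsQuad f S) : IsP2 f := by
  obtain ⟨hS, c, l, m, h⟩ := hf
  open MvPolynomial in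
  refine ⟨C c + C l * X 0 + C m * X 1 + (C (S 0 0 / 2) * X 0 ^ 2 + C (S 0 1) * (X 0 * X 1) +
    C (S 1 1 / 2) * X 1 ^ 2), ?_, fun x => ?_⟩
  · have hX : ∀ i : Fin 2, (X i : MvPolynomial (Fin 2) ℝ).totalDegree ≤ 1 :=
      fun i => (totalDegree_X i).le
    have hC : ∀ a : ℝ, (C a : MvPolynomial (Fin 2) ℝ).totalDegree ≤ 0 :=
      fun a => (totalDegree_C a).le
    have hadd : ∀ p q : MvPolynomial (Fin 2) ℝ, p.totalDegree ≤ 2 → q.totalDegree ≤ 2 →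
        (p + q).totalDegree ≤ 2 := fun p q hp hq => (totalDegree_add p q).trans (max_le hp hq)
    have h1 : ∀ (a : ℝ) (i : Fin 2),
        (C a * X i : MvPolynomial (Fin 2) ℝ).totalDegree ≤ 2 := fun a i => by
      have := totalDegree_mul (C a : MvPolynomial (Fin 2) ℝ) (X i)
      have := hX i; have := hC a; omega
    have h2 : ∀ (a : ℝ) (i j : Fin 2),
        (C a * (X i * X j) : MvPolynomial (Fin 2) ℝ).totalDegree ≤ 2 := fun a i j => by
      have := totalDegree_mul (C a : MvPolynomial (Fin 2) ℝ) (X i * X j)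
      have := totalDegree_mul (X i : MvPolynomial (Fin 2) ℝ) (X j)
      have := hX i; have := hX j; have := hC a; omega
    rw [sq, sq]
    exact hadd _ _ (hadd _ _ (hadd _ _ ((hC c).trans (by norm_num)) (h1 _ _)) (h1 _ _))
      (hadd _ _ (hadd _ _ (h2 _ _ _) (h2 _ _ _)) (h2 _ _ _))
  · rw [h]; simp [bil, ← hS]; ring

/-- Taylor's formula is exact for quadratics. The derivative is thereby expressed through values and
the Hessian, the two kinds of data prescribed for the interpolant. -/
theorem hasFDerivAt (hf : IsQuad f S) (x : Plane) :
    ∃ L : Plane →L[ℝ] ℝ, HasFDerivAt f L x ∧ ∀ v, L v = f (x + v) - f x - bil S v v / 2 := by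
  obtain ⟨hS, c, l, m, h⟩ := hf
  have p0 : HasFDerivAt (fun y : Plane => y 0) (EuclideanSpace.proj 0 : Plane →L[ℝ] ℝ) x :=
    (EuclideanSpace.proj (0 : Fin 2) : Plane →L[ℝ] ℝ).hasFDerivAt
  have p1 : HasFDerivAt (fun y : Plane => y 1) (EuclideanSpace.proj 1 : Plane →L[ℝ] ℝ) x :=
    (EuclideanSpace.proj (1 : Fin 2) : Plane →L[ℝ] ℝ).hasFDerivAt
  have hfe : f = fun y : Plane => c + l * y 0 + m * y 1 +
      (S 0 0 * (y 0 * y 0) + 2 * S 0 1 * (y 0 * y 1) + S 1 1 * (y 1 * y 1)) * (1 / 2) := by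
    funext y; rw [h]; simp only [bil, ← hS]; ring
  have hd := (((p0.const_mul l).const_add c).add (p1.const_mul m)).add
    (((((p0.mul p0).const_mul (S 0 0)).add ((p0.mul p1).const_mul (2 * S 0 1))).add
    ((p1.mul p1).const_mul (S 1 1))).mul_const (1 / 2))
  refine ⟨_, hd.congr_of_eventuallyEq (.of_forall fun y => by rw [hfe]; rfl), fun v => ?_⟩
  simp only [hfe]
  simp [bil, ← hS]
  ring

theorem differentiable (hf : IsQuad f S) : Differentiable ℝ f := fun x =>
  let ⟨_, hL, _⟩ := hf.hasFDerivAt x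
  hL.differentiableAt

theorem continuous (hf : IsQuad f S) : Continuous f := hf.differentiable.continuous

theorem fderiv_apply (hf : IsQuad f S) (x v : Plane) :
    fderiv ℝ f x v = f (x + v) - f x - bil S v v / 2 := by
  obtain ⟨L, hL, h⟩ := hf.hasFDerivAt x
  rw [hL.fderiv, h]

theorem contDiff (hf : IsQuad f S) : ContDiff ℝ ∞ f := by
  obtain ⟨hS, c, l, m, h⟩ := hf
  have hfe : f = fun y : Plane => c + l * y 0 + m * y 1 + bil S y y / 2 := funext h
  rw [hfe]; unfold bil; fun_prop

theorem partialDeriv_partialDeriv (hf : IsQuad f S) (i j : Fin 2) (x : Plane) :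
    partialDeriv j (partialDeriv i f) x = S i j := by
  obtain ⟨hS, c, l, m, h⟩ := id hf
  -- The first derivative is affine, hence itself quadratic with zero Hessian, and the same
  -- derivative formula applies to it again.
  have h1 : IsQuad (partialDeriv i f) (fun _ _ => 0) := by
    refine ⟨rfl, ![l, m] i, S i 0, S i 1, fun y => ?_⟩
    rw [partialDeriv, hf.fderiv_apply, h, h]
    fin_cases i <;> simp [bil, hS] <;> ring
  have h2 : ∀ y, partialDeriv i f y = ![l, m] i + S i 0 * y 0 + S i 1 * y 1 := by
    intro y
    rw [partialDeriv, hf.fderiv_apply, h, h]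
    fin_cases i <;> simp [bil, hS] <;> ring
  rw [partialDeriv, h1.fderiv_apply, h2, h2]
  fin_cases j <;> simp [bil] <;> ring

/-- The value at a midpoint. -/
theorem midpoint (hf : IsQuad f S) (a b : Plane) :
    f ((1 / 2 : ℝ) • (a + b)) = (f a + f b) / 2 - bil S (b - a) (b - a) / 8 := by
  obtain ⟨hS, c, l, m, h⟩ := hf
  simp only [h]; simp [bil, hS]; ring

theorem fderiv_midpoint_sub (hf : IsQuad f S) (a b : Plane) :
    fderiv ℝ f ((1 / 2 : ℝ) • (a + b)) (b - a) = f b - f a := by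
  rw [hf.fderiv_apply]
  obtain ⟨hS, c, l, m, h⟩ := hf
  simp only [h]; simp [bil, hS]; ring

/-- The normal derivative is affine along the edge, so the midpoint rule integrates it exactly. -/
theorem edgeFlux_eq (hf : IsQuad f S) (a b : Plane) :
    edgeFlux f a b = dist a b * fderiv ℝ f ((1 / 2 : ℝ) • (a + b)) (unitNormal a b) := by
  unfold edgeFlux
  congr 1
  generalize unitNormal a b = n
  have h1 : ∀ s : ℝ, fderiv ℝ f (a + s • (b - a)) n =
      fderiv ℝ f a n + s * bil S (b - a) n := by
    intro s
    rw [hf.fderiv_apply, hf.fderiv_apply]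
    obtain ⟨hS, c, l, m, h⟩ := hf
    simp only [h]; simp [bil, hS]; ring
  have h2 : fderiv ℝ f ((1 / 2 : ℝ) • (a + b)) n = fderiv ℝ f a n + 1 / 2 * bil S (b - a) n := by
    rw [← h1]; congr 2; apply plane_ext <;> simp <;> ring
  rw [h2, intervalIntegral.integral_congr (fun s _ => h1 s), intervalIntegral.integral_add
    intervalIntegrable_const (Continuous.intervalIntegrable (by fun_prop) _ _),
    intervalIntegral.integral_mul_const, integral_id]
  simp

end IsQuad

/-- Quadratic functions with prescribed Hessian and vertex values exist. -/
theorem exists_isQuad {P : Fin 3 → Plane} (hP : Nondeg P) {S : Fin 2 → Fin 2 → ℝ}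
    (hS : S 0 1 = S 1 0) (d : Fin 3 → ℝ) : ∃ q, IsQuad q S ∧ ∀ k, q (P k) = d k := by
  -- The values left for the affine part once the quadratic part is subtracted.
  set e : Fin 3 → ℝ := fun k => d k - bil S (P k) (P k) / 2 with he
  have hx : ∀ x, xiCoord P x = xiCoord P 0 + xiCoord P (P 0 + EuclideanSpace.single 0 1) * x 0 +
      xiCoord P (P 0 + EuclideanSpace.single 1 1) * x 1 := by
    intro x; simp [xiCoord, det2]; ring
  have hy : ∀ x, etaCoord P x = etaCoord P 0 +
      etaCoord P (P 0 + EuclideanSpace.single 0 1) * x 0 +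
      etaCoord P (P 0 + EuclideanSpace.single 1 1) * x 1 := by
    intro x; simp [etaCoord, det2]; ring
  refine ⟨fun x => e 0 + (e 1 - e 0) * xiCoord P x + (e 2 - e 0) * etaCoord P x + bil S x x / 2,
    ⟨hS, e 0 + (e 1 - e 0) * xiCoord P 0 + (e 2 - e 0) * etaCoord P 0,
      (e 1 - e 0) * xiCoord P (P 0 + EuclideanSpace.single 0 1) +
        (e 2 - e 0) * etaCoord P (P 0 + EuclideanSpace.single 0 1),
      (e 1 - e 0) * xiCoord P (P 0 + EuclideanSpace.single 1 1) +
        (e 2 - e 0) * etaCoord P (P 0 + EuclideanSpace.single 1 1),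
      fun x => by beta_reduce; rw [hx x, hy x]; ring⟩, fun k => ?_⟩
  have h1 : xiCoord P (P k) = (vertexCoord k).1 := by
    conv_lhs => rw [vertex_eq_point P k]
    exact xiCoord_point hP _ _
  have h2 : etaCoord P (P k) = (vertexCoord k).2 := by
    conv_lhs => rw [vertex_eq_point P k]
    exact etaCoord_point hP _ _
  simp only [h1, h2]
  fin_cases k <;> simp [vertexCoord, he]

/-! ### Functions with square integrable second differences -/

/-- `u` is continuous on `K`, and its mixed second differences over the parallelograms in `K` are
the integrals of the square integrable symmetric matrix field `H`. -/
structure HasHessian (K : Set Plane) (u : Plane → ℝ) (H : Fin 2 → Fin 2 → Plane → ℝ) : Prop where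
  continuousOn : ContinuousOn u K
  symm : ∀ i j x, H i j x = H j i x
  integrableOn : ∀ i j, IntegrableOn (H i j) K
  integrableOn_sq : ∀ i j, IntegrableOn (fun x => H i j x ^ 2) K
  second_difference : ∀ c a b, det2 a b ≠ 0 → para c a b ⊆ K →
    volume.real (para c a b) * (u c - u (c + a) - u (c + b) + u (c + a + b)) =
      bil (fun i j => ∫ x in para c a b, H i j x) a b

/-- The chain rule gives the factor `r ^ 2`. Homotheties map parallelograms to parallelograms, so
the second difference identity is inherited; this is what makes the recursion possible. -/
theorem HasHessian.comp_homot {K : Set Plane} (hK : MeasurableSet K) {u : Plane → ℝ}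
    {H : Fin 2 → Fin 2 → Plane → ℝ} (h : HasHessian K u H) (o n : Plane) {r : ℝ} (hr : r ≠ 0)
    (hsub : homot o n r '' K ⊆ K) :
    HasHessian K (fun x => u (homot o n r x)) (fun i j x => r ^ 2 * H i j (homot o n r x)) where
  continuousOn := h.continuousOn.comp (continuous_homot o n r).continuousOn
    (fun x hx => hsub (mem_image_of_mem _ hx))
  symm i j x := by rw [h.symm]
  integrableOn i j := ((integrableOn_image_homot o n hr hK (H i j)).1
    ((h.integrableOn i j).mono_set hsub)).const_mul _
  integrableOn_sq i j := by
    simp only [mul_pow]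
    exact ((integrableOn_image_homot o n hr hK (fun x => H i j x ^ 2)).1
      ((h.integrableOn_sq i j).mono_set hsub)).const_mul _
  second_difference c a b hab hc := by
    have hm := (isCompact_para c a b).isClosed.measurableSet
    have hr2 : r ^ 2 ≠ 0 := pow_ne_zero 2 hr
    have key := h.second_difference (homot o n r c) (r • a) (r • b)
      (by rw [det2_smul_smul]; exact mul_ne_zero hr2 hab)
      (by rw [← homot_image_para]; exact (image_mono hc).trans hsub)
    rw [← homot_image_para, volume_image_homot o n hr hm] at key
    simp only [setIntegral_image_homot o n hr hm] at key
    have e1 : homot o n r c + r • a = homot o n r (c + a) := by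
      apply plane_ext <;> simp [homot] <;> ring
    have e2 : homot o n r c + r • b = homot o n r (c + b) := by
      apply plane_ext <;> simp [homot] <;> ring
    have e3 : homot o n r (c + a) + r • b = homot o n r (c + a + b) := by
      apply plane_ext <;> simp [homot] <;> ring
    rw [e1, e2, e3] at key
    simp only [integral_const_mul]
    simp only [bil, PiLp.smul_apply, smul_eq_mul] at key ⊢
    apply mul_left_cancel₀ hr2
    rw [← mul_assoc, key]
    ring

/-! ### The interpolant belongs to the Fujino–Morley space -/

theorem tri_congr {P Q : Fin 3 → Plane} (h : range P = range Q) : tri P = tri Q := by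
  rw [tri, tri, h]

/-- The diagonal from `a` to `b` is the common edge, and the second triangle is the reflection of
the first in its midpoint. -/
theorem para_eq_union (c a b : Plane) :
    para c (a - c) (b - c) = tri ![c, a, b] ∪ tri ![a + b - c, b, a] := by
  apply subset_antisymm
  · rintro _ ⟨s, hs, t, ht, rfl⟩
    by_cases hst : s + t ≤ 1
    · left
      exact point_mem_tri ![c, a, b] hs.1 ht.1 hst
    · right
      have := point_mem_tri ![a + b - c, b, a] (s := 1 - s) (t := 1 - t) (by linarith [hs.2])
        (by linarith [ht.2]) (by linarith)
      convert this using 1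
      apply plane_ext <;> simp [point] <;> ring
  · have hc := convex_para c (a - c) (b - c)
    have m : ∀ s t : ℝ, s ∈ Icc (0:ℝ) 1 → t ∈ Icc (0:ℝ) 1 →
        c + s • (a - c) + t • (b - c) ∈ para c (a - c) (b - c) :=
      fun s t hs ht => ⟨s, hs, t, ht, rfl⟩
    have i0 : (0:ℝ) ∈ Icc (0:ℝ) 1 := by simp
    have i1 : (1:ℝ) ∈ Icc (0:ℝ) 1 := by simp
    have m00 : c ∈ para c (a - c) (b - c) := by simpa using m 0 0 i0 i0
    have m10 : a ∈ para c (a - c) (b - c) := by simpa using m 1 0 i1 i0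
    have m01 : b ∈ para c (a - c) (b - c) := by simpa using m 0 1 i0 i1
    have m11 : a + b - c ∈ para c (a - c) (b - c) := by
      have := m 1 1 i1 i1
      convert this using 1
      apply plane_ext <;> simp <;> ring
    apply union_subset <;> refine convexHull_min ?_ hc <;> rintro _ ⟨i, rfl⟩ <;> fin_cases i
    · exact m00
    · exact m10
    · exact m01
    · exact m11
    · exact m01
    · exact m10

theorem det2_perm_ne_zero {P : Fin 3 → Plane} (hP : Nondeg P) {k l m : Fin 3} (hkl : k ≠ l)
    (hmk : m ≠ k) (hml : m ≠ l) : det2 (P l - P k) (P m - P k) ≠ 0 := by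
  have h : det2 (P l - P k) (P m - P k) = det2 (P 1 - P 0) (P 2 - P 0) ∨
      det2 (P l - P k) (P m - P k) = -det2 (P 1 - P 0) (P 2 - P 0) := by
    simp only [det2, PiLp.sub_apply]
    fin_cases k <;> fin_cases l <;> fin_cases m <;> simp at hkl hmk hml <;>
      simp only [Fin.isValue, Fin.zero_eta, Fin.mk_one, Fin.reduceFinMk, true_or] <;>
      first
      | (left; ring1)
      | (right; ring1)
  unfold Nondeg at hP
  rcases h with h | h <;> rw [h]
  · exact hP
  · exact neg_ne_zero.2 hP

/-- Along the edge, the endpoint values determine the derivative at the midpoint `M`. Along the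
median `c - M`, one derivative is determined by the value at `c` and the other by the value at the
reflected vertex `a + b - c`; they agree exactly when the second difference of `u` is the mean of
the two Hessian forms. The two directions span the plane. -/
theorem fderiv_eq_of_neighbour {f g u : Plane → ℝ} {S T : Fin 2 → Fin 2 → ℝ} (hf : IsQuad f S)
    (hg : IsQuad g T) {a b c : Plane} (hdet : det2 (b - a) (c - a) ≠ 0) (hfa : f a = u a)
    (hfb : f b = u b) (hfc : f c = u c) (hga : g a = u a) (hgb : g b = u b)
    (hgc : g (a + b - c) = u (a + b - c))
    (h : 2 * (u c - u a - u b + u (a + b - c)) =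
      bil S (a - c) (b - c) + bil T (a - c) (b - c)) :
    fderiv ℝ f ((1 / 2 : ℝ) • (a + b)) = fderiv ℝ g ((1 / 2 : ℝ) • (a + b)) := by
  set M : Plane := (1 / 2 : ℝ) • (a + b) with hM
  have h1 : fderiv ℝ f M (b - a) = fderiv ℝ g M (b - a) := by
    rw [hf.fderiv_midpoint_sub, hg.fderiv_midpoint_sub, hfa, hfb, hga, hgb]
  have h2 : fderiv ℝ f M (c - M) = fderiv ℝ g M (c - M) := by
    have ef := hf.fderiv_apply M (c - M)
    have eg := hg.fderiv_apply M (M - c)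
    have e : M + (M - c) = a + b - c := by
      apply plane_ext <;> simp [hM] <;> ring
    rw [add_sub_cancel, hf.midpoint a b, hfa, hfb, hfc] at ef
    rw [e, hg.midpoint a b, hga, hgb, hgc, ← neg_sub c M, map_neg] at eg
    have hS := hf.1
    have hT := hg.1
    simp only [bil, hM, PiLp.sub_apply, PiLp.smul_apply, PiLp.add_apply, PiLp.neg_apply,
      smul_eq_mul, hS, hT] at ef eg h ⊢
    linear_combination ef + eg - h / 2 * (-1)
  have hd : det2 (b - a) (c - M) = det2 (b - a) (c - a) := by
    simp [det2, hM]; ring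
  rw [← hd] at hdet
  ext v
  rw [← cramer hdet v]
  simp only [map_add, map_smul, h1, h2]

/-- The two elements have equal area, so the mean of `H` over their union is the mean of `S` and
`T`. The claim is the second difference identity on that parallelogram. -/
theorem bil_average {P : Fin 3 → Plane} (hP : Nondeg P) {N : ℕ} (hN : 1 ≤ N)
    {u : Plane → ℝ} {H : Fin 2 → Fin 2 → Plane → ℝ} (h : HasHessian (tri P) u H)
    {s t : UniformIndex N} (hst : s ≠ t) {k l k' l' m : Fin 3} (hkl : k ≠ l) (hmk : m ≠ k)
    (hml : m ≠ l) (hk : uniformMesh P N s k = uniformMesh P N t k')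
    (hl : uniformMesh P N s l = uniformMesh P N t l')
    {S T : Fin 2 → Fin 2 → ℝ}
    (hS : ∀ i j, volume.real (tri (uniformMesh P N s)) * S i j =
      ∫ x in tri (uniformMesh P N s), H i j x)
    (hT : ∀ i j, volume.real (tri (uniformMesh P N t)) * T i j =
      ∫ x in tri (uniformMesh P N t), H i j x) :
    2 * (u (uniformMesh P N s m) - u (uniformMesh P N s k) - u (uniformMesh P N s l) +
        u (uniformMesh P N s k + uniformMesh P N s l - uniformMesh P N s m)) =
      bil S (uniformMesh P N s k - uniformMesh P N s m)
        (uniformMesh P N s l - uniformMesh P N s m) +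
      bil T (uniformMesh P N s k - uniformMesh P N s m)
        (uniformMesh P N s l - uniformMesh P N s m) := by
  obtain ⟨-, hsum⟩ := neighbour hP hN hst hkl hk hl
  have hnd : Nondeg (uniformMesh P N s) := by
    rw [uniformMesh_eq]; exact nondeg_homot _ _ (meshRatio_ne_zero hN s) hP
  have hdet := det2_perm_ne_zero hnd hmk hml.symm hkl.symm
  have hvol : volume.real (tri (uniformMesh P N t)) = volume.real (tri (uniformMesh P N s)) := by
    rw [tri_uniformMesh hP hN, tri_uniformMesh hP hN, meshMap, meshMap,
      volume_image_homot _ _ (meshRatio_ne_zero hN t) (measurableSet_tri P),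
      volume_image_homot _ _ (meshRatio_ne_zero hN s) (measurableSet_tri P), meshRatio_sq,
      meshRatio_sq]
  have hcov : ∀ i : Fin 3, i = m ∨ i = k ∨ i = l := by
    revert hkl hmk hml; clear hk hl hdet hsum; revert k l m; decide
  have hs : tri (uniformMesh P N s) =
      tri ![uniformMesh P N s m, uniformMesh P N s k, uniformMesh P N s l] := by
    apply tri_congr
    ext x; constructor
    · rintro ⟨i, rfl⟩
      rcases hcov i with rfl | rfl | rfl
      · exact ⟨0, rfl⟩
      · exact ⟨1, rfl⟩
      · exact ⟨2, rfl⟩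
    · rintro ⟨i, rfl⟩
      fin_cases i <;> exact mem_range_self _
  have ht : tri (uniformMesh P N t) =
      tri ![uniformMesh P N s k + uniformMesh P N s l - uniformMesh P N s m,
        uniformMesh P N s l, uniformMesh P N s k] := by
    have em := eq_sub_of_add_eq' (hsum m)
    have ek : uniformMesh P N t k = uniformMesh P N s l := add_left_cancel (hsum k)
    have el : uniformMesh P N t l = uniformMesh P N s k :=
      add_left_cancel ((hsum l).trans (add_comm _ _))
    rw [← em, ← ek, ← el]
    apply tri_congr
    ext x; constructor
    · rintro ⟨i, rfl⟩
      rcases hcov i with rfl | rfl | rfl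
      · exact ⟨0, rfl⟩
      · exact ⟨1, rfl⟩
      · exact ⟨2, rfl⟩
    · rintro ⟨i, rfl⟩
      fin_cases i <;> exact mem_range_self _
  set a := uniformMesh P N s k
  set b := uniformMesh P N s l
  set c := uniformMesh P N s m
  have hpara := para_eq_union c a b
  rw [← hs, ← ht] at hpara
  have hint : ∀ f : Plane → ℝ, IntegrableOn f (tri P) → ∫ x in para c (a - c) (b - c), f x =
      (∫ x in tri (uniformMesh P N s), f x) + ∫ x in tri (uniformMesh P N t), f x := by
    intro f hf
    rw [hpara]
    exact setIntegral_union₀ (aedisjoint_uniformMesh hP hN hst)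
      (measurableSet_tri _).nullMeasurableSet
      (hf.mono_set (tri_uniformMesh_subset hP hN s)) (hf.mono_set (tri_uniformMesh_subset hP hN t))
  have hv := hint (fun _ => 1) (integrableOn_const (isCompact_tri P).measure_lt_top.ne)
  simp only [setIntegral_const, smul_eq_mul, mul_one, hvol] at hv
  have key := h.second_difference c (a - c) (b - c) hdet (by
    rw [hpara]
    exact union_subset (tri_uniformMesh_subset hP hN s) (tri_uniformMesh_subset hP hN t))
  simp only [hint _ (h.integrableOn _ _), ← hS, ← hT, hv, hvol] at key
  have e3 : c + (a - c) + (b - c) = a + b - c := by abel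
  rw [e3, add_sub_cancel, add_sub_cancel] at key
  apply mul_left_cancel₀ (volume_tri_pos hnd).ne'
  simp only [bil] at key ⊢
  linear_combination key

/-- The full gradients of neighbouring interpolants agree at edge midpoints, so their fluxes agree;
subtracting one global quadratic preserves this. Its Hessian `R` is arbitrary, which later allows `q
= 0`. -/
theorem interpolant_sub_mem_VFM {P : Fin 3 → Plane} (hP : Nondeg P) {N : ℕ} (hN : 1 ≤ N)
    {u : Plane → ℝ} {H : Fin 2 → Fin 2 → Plane → ℝ} (h : HasHessian (tri P) u H)
    {p : UniformIndex N → Plane → ℝ} {S : UniformIndex N → Fin 2 → Fin 2 → ℝ}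
    (hp : ∀ s, IsQuad (p s) (S s)) (hpu : ∀ s k, p s (uniformMesh P N s k) =
      u (uniformMesh P N s k))
    (hS : ∀ s i j, volume.real (tri (uniformMesh P N s)) * S s i j =
      ∫ x in tri (uniformMesh P N s), H i j x)
    {q : Plane → ℝ} {R : Fin 2 → Fin 2 → ℝ} (hq : IsQuad q R) (hqu : ∀ k, q (P k) = u (P k)) :
    (fun s x => p s x - q x) ∈ VFM P (uniformMesh P N) := by
  refine ⟨fun s => ((hp s).sub hq).isP2, ?_, ?_, ?_⟩
  · intro s k i hki
    simp only [hqu]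
    rw [← hki, hpu, sub_self]
  · intro t s k l hkl
    simp only [hpu t]
    rw [hkl, hpu s]
  · intro s t k l k' l' hkl hk hl
    by_cases hst : s = t
    · rw [hst]
    obtain ⟨m, hmk, hml⟩ : ∃ m : Fin 3, m ≠ k ∧ m ≠ l := by
      clear hk hl; revert hkl; revert k l; decide
    have hnd : Nondeg (uniformMesh P N s) := by
      rw [uniformMesh_eq]; exact nondeg_homot _ _ (meshRatio_ne_zero hN s) hP
    obtain ⟨-, hsum⟩ := neighbour hP hN hst hkl hk hl
    have em := eq_sub_of_add_eq' (hsum m)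
    have hD := fderiv_eq_of_neighbour (hp s) (hp t) (u := u)
      (det2_perm_ne_zero hnd hkl hmk hml) (hpu s k) (hpu s l) (hpu s m)
      (by rw [hk, hpu]) (by rw [hl, hpu]) (by rw [← em, hpu])
      (bil_average hP hN h hst hkl hmk hml hk hl (hS s) (hS t))
    rw [((hp s).sub hq).edgeFlux_eq, ((hp t).sub hq).edgeFlux_eq,
      fderiv_fun_sub ((hp s).differentiable _) (hq.differentiable _),
      fderiv_fun_sub ((hp t).differentiable _) (hq.differentiable _), hD]

end FujinoMorley

/-! ### Norms, energy and the recursion under refinement -/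

namespace FujinoMorley

/-! ### Point values and the `L^∞` norm -/

/-- A value above the essential supremum would persist on a relative neighbourhood, which meets the
interior in a nonempty open set, hence in positive measure. -/
theorem enorm_le_eLpNorm_top {K : Set Plane} (hK : closure (interior K) = K)
    {f : Plane → ℝ} (hf : ContinuousOn f K) {x : Plane} (hx : x ∈ K) :
    ‖f x‖ₑ ≤ eLpNorm f ∞ (volume.restrict K) := by
  by_contra! hlt
  set M := eLpNorm f ∞ (volume.restrict K) with hM
  have hae : ∀ᵐ y ∂(volume.restrict K), ‖f y‖ₑ ≤ M := by
    rw [hM, eLpNorm_exponent_top]; exact ae_le_eLpNormEssSup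
  have hnhds : {y | M < ‖f y‖ₑ} ∈ nhdsWithin x K :=
    (hf.enorm x hx).eventually (lt_mem_nhds hlt)
  obtain ⟨O, hO, hxO, hOK⟩ := mem_nhdsWithin.1 hnhds
  obtain ⟨y, hyO, hyK⟩ : (O ∩ interior K).Nonempty := by
    rw [← hK] at hx
    exact mem_closure_iff.1 hx O hO hxO
  have hpos : 0 < volume (O ∩ interior K) :=
    (hO.inter isOpen_interior).measure_pos volume ⟨y, hyO, hyK⟩
  have hzero : volume (O ∩ interior K) = 0 := by
    have h1 := ae_restrict_iff' (hK ▸ isClosed_closure : IsClosed K).measurableSet |>.1 hae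
    refine measure_mono_null ?_ h1
    rintro z ⟨hzO, hzK⟩ hz
    exact absurd (hz (interior_subset hzK)) (not_le.2 (hOK ⟨hzO, interior_subset hzK⟩))
  exact hpos.ne' hzero

theorem eLpNorm_top_le {K : Set Plane} (hK : MeasurableSet K) {f : Plane → ℝ} {M : ℝ}
    (hf : ∀ x ∈ K, |f x| ≤ M) : eLpNorm f ∞ (volume.restrict K) ≤ ENNReal.ofReal M := by
  rw [eLpNorm_exponent_top]
  exact eLpNormEssSup_le_of_ae_bound ((ae_restrict_iff' hK).2 (.of_forall hf))

theorem eLpNorm_top_lt_top {K : Set Plane} (hK : IsCompact K) {f : Plane → ℝ}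
    (hf : ContinuousOn f K) : eLpNorm f ∞ (volume.restrict K) < ⊤ := by
  obtain ⟨M, hM⟩ := hK.exists_bound_of_continuousOn hf
  exact (eLpNorm_top_le hK.isClosed.measurableSet hM).trans_lt ENNReal.ofReal_lt_top

theorem abs_le_linftyNorm {P : Fin 3 → Plane} (hP : Nondeg P) {f : Plane → ℝ}
    (hf : ContinuousOn f (tri P)) {x : Plane} (hx : x ∈ tri P) :
    |f x| ≤ linftyNorm (tri P) f := by
  have h := ENNReal.toReal_mono (eLpNorm_top_lt_top (isCompact_tri P) hf).ne
    (enorm_le_eLpNorm_top (closure_interior_tri hP) hf hx)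
  simpa [linftyNorm] using h

theorem linftyNorm_le {P : Fin 3 → Plane} {f : Plane → ℝ} {M : ℝ} (hM : 0 ≤ M)
    (hf : ∀ x ∈ tri P, |f x| ≤ M) : linftyNorm (tri P) f ≤ M :=
  ENNReal.toReal_le_of_le_ofReal hM (eLpNorm_top_le (measurableSet_tri P) hf)

theorem abs_le_brokenLinftyNorm {ι : Type} [Finite ι] {T : ι → Fin 3 → Plane}
    (hT : ∀ t, Nondeg (T t)) {v : ι → Plane → ℝ} (hv : ∀ t, Continuous (v t)) (t : ι) {x : Plane}
    (hx : x ∈ tri (T t)) : |v t x| ≤ brokenLinftyNorm T v := by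
  -- `toReal` is monotone only below `⊤`, so the supremum must first be shown finite.
  have hfin : (⨆ t, eLpNorm (v t) ∞ (volume.restrict (tri (T t)))) ≠ ⊤ := by
    cases nonempty_fintype ι
    rw [← Finset.sup_univ_eq_iSup]
    refine ((Finset.sup_lt_iff (by simp)).2 fun t _ => ?_).ne
    exact eLpNorm_top_lt_top (isCompact_tri _) (hv t).continuousOn
  have h := ENNReal.toReal_mono hfin ((enorm_le_eLpNorm_top (closure_interior_tri (hT t))
    (hv t).continuousOn hx).trans (le_iSup (fun t => eLpNorm (v t) ∞ (volume.restrict (tri (T t)))) t))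
  simpa [brokenLinftyNorm] using h

theorem brokenSeminormSq_nonneg {ι : Type} [Fintype ι] (T : ι → Fin 3 → Plane)
    (v : ι → Plane → ℝ) : 0 ≤ brokenSeminormSq T v :=
  Finset.sum_nonneg fun _ _ => integral_nonneg fun _ => Finset.sum_nonneg fun _ _ =>
    Finset.sum_nonneg fun _ _ => sq_nonneg _

theorem lamH_nonneg {ι : Type} [Fintype ι] (P : Fin 3 → Plane) (T : ι → Fin 3 → Plane) :
    0 ≤ lamH P T := by
  apply Real.sInf_nonneg
  rintro r ⟨v, -, -, rfl⟩
  exact div_nonneg (brokenSeminormSq_nonneg T v) (sq_nonneg _)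

theorem lamH_mul_le {ι : Type} [Fintype ι] {P : Fin 3 → Plane} {T : ι → Fin 3 → Plane}
    {v : ι → Plane → ℝ} (hv : v ∈ VFM P T) :
    lamH P T * brokenLinftyNorm T v ^ 2 ≤ brokenSeminormSq T v := by
  by_cases h0 : brokenLinftyNorm T v = 0
  · rw [h0]; simpa using brokenSeminormSq_nonneg T v
  · rw [← le_div_iff₀ (by positivity)]
    refine csInf_le ⟨0, ?_⟩ ⟨v, hv, h0, rfl⟩
    rintro r ⟨v, -, -, rfl⟩
    exact div_nonneg (brokenSeminormSq_nonneg T v) (sq_nonneg _)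

theorem brokenSeminormSq_of_isQuad {ι : Type} [Fintype ι] {T : ι → Fin 3 → Plane}
    {v : ι → Plane → ℝ} {S : ι → Fin 2 → Fin 2 → ℝ} (hv : ∀ t, IsQuad (v t) (S t)) :
    brokenSeminormSq T v = ∑ t, ∑ i, ∑ j, volume.real (tri (T t)) * S t i j ^ 2 := by
  unfold brokenSeminormSq
  refine Finset.sum_congr rfl fun t _ => ?_
  simp only [(hv t).partialDeriv_partialDeriv, setIntegral_const, smul_eq_mul, Finset.mul_sum]

/-! ### The energy -/

/-- The squared `L²` distance on the triangle of the matrix field `H` to the constant `S`. -/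
noncomputable def energy (P : Fin 3 → Plane) (H : Fin 2 → Fin 2 → Plane → ℝ) (S : Fin 2 → Fin 2 → ℝ) : ℝ :=
  ∑ i, ∑ j, ∫ x in tri P, (H i j x - S i j) ^ 2

theorem energy_nonneg (P : Fin 3 → Plane) (H : Fin 2 → Fin 2 → Plane → ℝ)
    (S : Fin 2 → Fin 2 → ℝ) : 0 ≤ energy P H S :=
  Finset.sum_nonneg fun _ _ => Finset.sum_nonneg fun _ _ => integral_nonneg fun _ => sq_nonneg _

theorem integrableOn_sub_sq {P : Fin 3 → Plane} {f : Plane → ℝ} (hf : IntegrableOn f (tri P))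
    (hf2 : IntegrableOn (fun x => f x ^ 2) (tri P)) (a : ℝ) :
    IntegrableOn (fun x => (f x - a) ^ 2) (tri P) := by
  have : (fun x => (f x - a) ^ 2) = fun x => f x ^ 2 - 2 * a * f x + a ^ 2 := by
    funext x; ring
  rw [this]
  exact (hf2.sub (hf.const_mul _)).add (integrableOn_const (isCompact_tri P).measure_lt_top.ne)

/-- Pythagoras: `m` is the mean of `f`, so `f - m` is orthogonal to constants. -/
theorem setIntegral_sub_sq {P : Fin 3 → Plane} {f : Plane → ℝ} (hf : IntegrableOn f (tri P))
    (hf2 : IntegrableOn (fun x => f x ^ 2) (tri P)) {m : ℝ}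
    (hm : volume.real (tri P) * m = ∫ x in tri P, f x) (a : ℝ) :
    ∫ x in tri P, (f x - a) ^ 2 =
      (∫ x in tri P, (f x - m) ^ 2) + volume.real (tri P) * (m - a) ^ 2 := by
  have h : ∀ b : ℝ, ∫ x in tri P, (f x - b) ^ 2 =
      (∫ x in tri P, f x ^ 2) - 2 * b * (volume.real (tri P) * m) + volume.real (tri P) * b ^ 2 := by
    intro b
    have : (fun x => (f x - b) ^ 2) = fun x => f x ^ 2 - 2 * b * f x + b ^ 2 := by
      funext x; ring
    have hc : IntegrableOn (fun _ => b ^ 2) (tri P) :=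
      integrableOn_const (isCompact_tri P).measure_lt_top.ne
    have hs : IntegrableOn (fun x => f x ^ 2 - 2 * b * f x) (tri P) := hf2.sub (hf.const_mul _)
    rw [this, integral_add hs hc, integral_sub hf2 (hf.const_mul _),
      integral_const_mul, hm, setIntegral_const, smul_eq_mul]
  rw [h a, h m]; ring

/-! ### Self-similarity and refinement -/

section Pullback

variable {P : Fin 3 → Plane} {N : ℕ} {u : Plane → ℝ} {H : Fin 2 → Fin 2 → Plane → ℝ}

/-- The matrix field belonging to the pullback of a function to the large triangle. -/
noncomputable def pullHessian (P : Fin 3 → Plane) (N : ℕ) (s : UniformIndex N) (H : Fin 2 → Fin 2 → Plane → ℝ) :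
    Fin 2 → Fin 2 → Plane → ℝ :=
  fun i j x => meshRatio N s ^ 2 * H i j (meshMap P N s x)

theorem HasHessian.pull (hP : Nondeg P) (hN : 1 ≤ N) (h : HasHessian (tri P) u H)
    (s : UniformIndex N) :
    HasHessian (tri P) (fun x => u (meshMap P N s x)) (pullHessian P N s H) :=
  h.comp_homot (measurableSet_tri P) _ _ (meshRatio_ne_zero hN s) (by
    have := tri_uniformMesh_subset hP hN s
    rwa [tri_uniformMesh hP hN] at this)

theorem setIntegral_uniformMesh (hP : Nondeg P) (hN : 1 ≤ N) (s : UniformIndex N)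
    (f : Plane → ℝ) : ∫ x in tri (uniformMesh P N s), f x =
      meshRatio N s ^ 2 * ∫ x in tri P, f (meshMap P N s x) := by
  rw [tri_uniformMesh hP hN]
  exact setIntegral_image_homot _ _ (meshRatio_ne_zero hN s) (measurableSet_tri P) f

theorem setIntegral_pullHessian (hP : Nondeg P) (hN : 1 ≤ N) (s : UniformIndex N) (i j : Fin 2)
    (a : ℝ) : ∫ x in tri P, (pullHessian P N s H i j x - meshRatio N s ^ 2 * a) ^ 2 =
      meshRatio N s ^ 2 * ∫ x in tri (uniformMesh P N s), (H i j x - a) ^ 2 := by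
  rw [setIntegral_uniformMesh hP hN, ← integral_const_mul, ← integral_const_mul]
  refine integral_congr_ae (.of_forall fun x => ?_)
  simp only [pullHessian]; ring

/-- Makes the Hessian term of the crude interpolation estimate shrink by `1/N` at each refinement.
-/
theorem energy_pullHessian_le (hP : Nondeg P) (hN : 1 ≤ N) (h : HasHessian (tri P) u H)
    (s : UniformIndex N) :
    energy P (pullHessian P N s H) (fun _ _ => 0) ≤
      (1 / (N : ℝ)) ^ 2 * energy P H (fun _ _ => 0) := by
  unfold energy
  simp only [Finset.mul_sum]
  refine Finset.sum_le_sum fun i _ => Finset.sum_le_sum fun j _ => ?_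
  have := setIntegral_pullHessian (H := H) hP hN s i j 0
  rw [mul_zero] at this
  rw [this, meshRatio_sq]
  refine mul_le_mul_of_nonneg_left ?_ (by positivity)
  exact setIntegral_mono_set (integrableOn_sub_sq (h.integrableOn i j) (h.integrableOn_sq i j) 0)
    (.of_forall fun x => sq_nonneg _) (tri_uniformMesh_subset hP hN s).eventuallyLE

theorem sqrt_energy_pullHessian_le (hP : Nondeg P) (hN : 1 ≤ N) (h : HasHessian (tri P) u H)
    (s : UniformIndex N) :
    √(energy P (pullHessian P N s H) fun _ _ => 0) ≤
      1 / (N : ℝ) * √(energy P H fun _ _ => 0) := by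
  rw [← Real.sqrt_sq (show (0:ℝ) ≤ 1 / N by positivity), ← Real.sqrt_mul (sq_nonneg _)]
  exact Real.sqrt_le_sqrt (energy_pullHessian_le hP hN h s)

theorem meshMap_dist (s : UniformIndex N) (x y : Plane) :
    dist (meshMap P N s x) (meshMap P N s y) = 1 / (N : ℝ) * dist x y := by
  have : meshMap P N s x - meshMap P N s y = meshRatio N s • (x - y) := by
    apply plane_ext <;> simp [meshMap, homot] <;> ring
  rw [dist_eq_norm, this, norm_smul, Real.norm_eq_abs, abs_meshRatio, dist_eq_norm]

/-- The element-wise orthogonal splitting of the energy. -/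
theorem energy_split (hP : Nondeg P) (hN : 1 ≤ N) (h : HasHessian (tri P) u H)
    {S : UniformIndex N → Fin 2 → Fin 2 → ℝ}
    (hS : ∀ s i j, volume.real (tri (uniformMesh P N s)) * S s i j =
      ∫ x in tri (uniformMesh P N s), H i j x) (R : Fin 2 → Fin 2 → ℝ) :
    energy P H R = ∑ s, energy (uniformMesh P N s) H (S s) +
      ∑ s, ∑ i, ∑ j, volume.real (tri (uniformMesh P N s)) * (S s i j - R i j) ^ 2 := by
  have hij : ∀ i j, ∫ x in tri P, (H i j x - R i j) ^ 2 =
      ∑ s, ((∫ x in tri (uniformMesh P N s), (H i j x - S s i j) ^ 2) +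
        volume.real (tri (uniformMesh P N s)) * (S s i j - R i j) ^ 2) := by
    intro i j
    rw [← sum_setIntegral_uniformMesh hP hN
      (integrableOn_sub_sq (h.integrableOn i j) (h.integrableOn_sq i j) _)]
    refine Finset.sum_congr rfl fun s _ => ?_
    have hsub := tri_uniformMesh_subset hP hN s
    exact setIntegral_sub_sq ((h.integrableOn i j).mono_set hsub)
      ((h.integrableOn_sq i j).mono_set hsub) (hS s i j) _
  unfold energy
  simp only [hij, Fin.sum_univ_two, Finset.sum_add_distrib]

/-- An affine interpolation error estimate for functions with quadratic interpolant. -/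
theorem abs_sub_le_of_oscillation (hP : Nondeg P) {q : Plane → ℝ} {S : Fin 2 → Fin 2 → ℝ}
    (hq : IsQuad q S) (hqu : ∀ k, q (P k) = u (P k)) {δ m ρ : ℝ}
    (hosc : ∀ x ∈ tri P, ∀ y ∈ tri P, |u x - u y| ≤ δ) (hS : ∀ i j, |S i j| ≤ m)
    (hρ : ∀ x ∈ tri P, ∀ i, |x i| ≤ ρ) {x : Plane} (hx : x ∈ tri P) :
    |u x - q x| ≤ δ + 4 * m * ρ ^ 2 := by
  obtain ⟨h1, h2, h3⟩ := (mem_tri_iff hP x).1 hx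
  set s := xiCoord P x
  set t := etaCoord P x
  have hxe : x = point P s t := (point_coord hP x).symm
  have hbil : ∀ y ∈ tri P, |bil S y y| ≤ 4 * m * ρ ^ 2 := by
    intro y hy
    have hm0 : 0 ≤ m := (abs_nonneg _).trans (hS 0 0)
    have term : ∀ i j, |S i j * y i * y j| ≤ m * ρ ^ 2 := by
      intro i j
      rw [abs_mul, abs_mul, sq, ← mul_assoc]
      exact mul_le_mul (mul_le_mul (hS i j) (hρ y hy i) (abs_nonneg _) hm0) (hρ y hy j)
        (abs_nonneg _) (mul_nonneg hm0 ((abs_nonneg _).trans (hρ y hy i)))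
    unfold bil
    have a1 := abs_le.1 (term 0 0)
    have a2 := abs_le.1 (term 0 1)
    have a3 := abs_le.1 (term 1 0)
    have a4 := abs_le.1 (term 1 1)
    rw [abs_le]; constructor <;> linarith
  -- The barycentric interpolant of the vertex values, corrected by the deviation of the quadratic
  -- part from its own barycentric interpolant.
  have hqx : q x = (1 - s - t) * q (P 0) + s * q (P 1) + t * q (P 2) + (bil S x x -
      ((1 - s - t) * bil S (P 0) (P 0) + s * bil S (P 1) (P 1) + t * bil S (P 2) (P 2))) / 2 := by
    obtain ⟨hS, c, l, m, h⟩ := hq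
    simp only [h]
    have hx0 : x 0 = P 0 0 + s * (P 1 0 - P 0 0) + t * (P 2 0 - P 0 0) := by
      conv_lhs => rw [hxe]
      simp [point]
    have hx1 : x 1 = P 0 1 + s * (P 1 1 - P 0 1) + t * (P 2 1 - P 0 1) := by
      conv_lhs => rw [hxe]
      simp [point]
    rw [hx0, hx1]; ring
  rw [hqx, hqu, hqu, hqu]
  have b := abs_le.1 (hbil x hx)
  have b0 := abs_le.1 (hbil _ (vertex_mem_tri P 0))
  have b1 := abs_le.1 (hbil _ (vertex_mem_tri P 1))
  have b2 := abs_le.1 (hbil _ (vertex_mem_tri P 2))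
  have o0 := abs_le.1 (hosc x hx _ (vertex_mem_tri P 0))
  have o1 := abs_le.1 (hosc x hx _ (vertex_mem_tri P 1))
  have o2 := abs_le.1 (hosc x hx _ (vertex_mem_tri P 2))
  have h0 : 0 ≤ 1 - s - t := by linarith
  rw [abs_le]
  constructor
  · linarith [mul_le_mul_of_nonneg_left o0.1 h0, mul_le_mul_of_nonneg_left o1.1 h1,
      mul_le_mul_of_nonneg_left o2.1 h2, mul_le_mul_of_nonneg_left b0.1 h0,
      mul_le_mul_of_nonneg_left b1.1 h1, mul_le_mul_of_nonneg_left b2.1 h2]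
  · linarith [mul_le_mul_of_nonneg_left o0.2 h0, mul_le_mul_of_nonneg_left o1.2 h1,
      mul_le_mul_of_nonneg_left o2.2 h2, mul_le_mul_of_nonneg_left b0.2 h0,
      mul_le_mul_of_nonneg_left b1.2 h1, mul_le_mul_of_nonneg_left b2.2 h2]

/-- `q` interpolates `u` at the vertices, and its Hessian is the average of `H`. -/
structure IsInterpolant (P : Fin 3 → Plane) (u : Plane → ℝ) (H : Fin 2 → Fin 2 → Plane → ℝ)
    (q : Plane → ℝ) (S : Fin 2 → Fin 2 → ℝ) : Prop where
  isQuad : IsQuad q S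
  vertex : ∀ k, q (P k) = u (P k)
  average : ∀ i j, volume.real (tri P) * S i j = ∫ x in tri P, H i j x

theorem exists_isInterpolant (hP : Nondeg P) (h : HasHessian (tri P) u H) :
    ∃ q S, IsInterpolant P u H q S := by
  -- The mean of `H` can be the Hessian of a quadratic only because `H` is symmetric.
  have hsymm : H 0 1 = H 1 0 := funext (h.symm 0 1)
  obtain ⟨q, hq, hqu⟩ := exists_isQuad hP
    (S := fun i j => (∫ x in tri P, H i j x) / volume.real (tri P)) (by simp only [hsymm])
    (fun k => u (P k))
  exact ⟨q, _, hq, hqu, fun i j => mul_div_cancel₀ _ (volume_tri_pos hP).ne'⟩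

/-- The squared mean is at most the mean square, by the Pythagorean splitting about the mean. -/
theorem IsInterpolant.abs_hessian_le (hP : Nondeg P) (h : HasHessian (tri P) u H)
    {q : Plane → ℝ} {S : Fin 2 → Fin 2 → ℝ} (hq : IsInterpolant P u H q S) (i j : Fin 2) :
    |S i j| ≤ √(energy P H (fun _ _ => 0) / volume.real (tri P)) := by
  have hv := volume_tri_pos hP
  apply Real.abs_le_sqrt
  rw [le_div_iff₀ hv]
  have h1 := setIntegral_sub_sq (h.integrableOn i j) (h.integrableOn_sq i j) (hq.average i j) 0
  have h2 : 0 ≤ ∫ x in tri P, (H i j x - S i j) ^ 2 := integral_nonneg fun _ => sq_nonneg _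
  have h3 : ∫ x in tri P, (H i j x - 0) ^ 2 ≤ energy P H (fun _ _ => 0) := by
    have hn : ∀ i j, 0 ≤ ∫ x in tri P, (H i j x - 0) ^ 2 :=
      fun i j => integral_nonneg fun _ => sq_nonneg _
    refine (Finset.single_le_sum (f := fun j => ∫ x in tri P, (H i j x - 0) ^ 2)
      (fun j _ => hn i j) (Finset.mem_univ j)).trans ?_
    exact Finset.single_le_sum (f := fun i => ∑ j, ∫ x in tri P, (H i j x - 0) ^ 2)
      (fun i _ => Finset.sum_nonneg fun j _ => hn i j) (Finset.mem_univ i)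
  rw [sub_zero] at h1
  linarith

/-- Weighted Cauchy–Schwarz, `(x + y)² ≤ x²/n + y²/(1-n)`. The same constant `1/(a(1-n))` stands on
both sides, so it survives each refinement unchanged. -/
theorem add_sqrt_le {n a E Z : ℝ} (hn0 : 0 < n) (hn1 : n < 1) (ha : 0 < a) (hE : 0 ≤ E)
    (hZ : 0 ≤ Z) :
    √(1 / (a * (1 - n)) * E) + √(Z / a) ≤ √(1 / (a * (1 - n)) * (E / n + Z)) := by
  have hn : 0 < 1 - n := by linarith
  apply Real.le_sqrt_of_sq_le
  set x := √(1 / (a * (1 - n)) * E)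
  set y := √(Z / a)
  have hx : x ^ 2 = 1 / (a * (1 - n)) * E := Real.sq_sqrt (by positivity)
  have hy : y ^ 2 = Z / a := Real.sq_sqrt (by positivity)
  have e : 1 / (a * (1 - n)) * (E / n + Z) = x ^ 2 / n + y ^ 2 / (1 - n) := by
    rw [hx, hy]; field_simp
  have e2 : x ^ 2 / n + y ^ 2 / (1 - n) - (x + y) ^ 2 =
      ((1 - n) * x - n * y) ^ 2 / (n * (1 - n)) := by
    field_simp; ring
  have : 0 ≤ ((1 - n) * x - n * y) ^ 2 / (n * (1 - n)) := by positivity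
  rw [e]; linarith

/-- One refinement step. -/
theorem abs_sub_le_of_children (hP : Nondeg P) (hN : 2 ≤ N)
    (hlam : 0 < lamH P (uniformMesh P N)) (h : HasHessian (tri P) u H)
    {q : Plane → ℝ} {R : Fin 2 → Fin 2 → ℝ} (hq : IsQuad q R) (hqu : ∀ k, q (P k) = u (P k))
    {δ : ℝ} (hchild : ∀ s : UniformIndex N, ∀ p S,
      IsInterpolant P (fun x => u (meshMap P N s x)) (pullHessian P N s H) p S → ∀ y ∈ tri P,
        |u (meshMap P N s y) - p y| ≤ √(1 / (lamH P (uniformMesh P N) * (1 - (1 / (N : ℝ)) ^ 2)) *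
          energy P (pullHessian P N s H) S) + δ) {x : Plane} (hx : x ∈ tri P) :
    |u x - q x| ≤ √(1 / (lamH P (uniformMesh P N) * (1 - (1 / (N : ℝ)) ^ 2)) *
      energy P H R) + δ := by
  have hN1 : 1 ≤ N := by omega
  have hN' : (2 : ℝ) ≤ N := by exact_mod_cast hN
  choose p S hp using fun s => exists_isInterpolant hP (h.pull hP hN1 s)
  set inv : UniformIndex N → Plane → Plane :=
    fun s => homot (uniformMesh P N s 0) (P 0) (meshRatio N s)⁻¹ with hinv
  have hcancel : ∀ s y, inv s (meshMap P N s y) = y := by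
    intro s y
    have := meshRatio_ne_zero hN1 s
    apply plane_ext <;> simp [hinv, homot, meshMap, this]
  -- Transports the interpolants from `K` back to the elements; the Hessians scale by the inverse
  -- square of the ratio.
  set p' : UniformIndex N → Plane → ℝ := fun s y => p s (inv s y) with hp'
  set S' : UniformIndex N → Fin 2 → Fin 2 → ℝ := fun s i j => (meshRatio N s)⁻¹ ^ 2 * S s i j
    with hS'
  have hSS : ∀ s i j, S s i j = meshRatio N s ^ 2 * S' s i j := by
    intro s i j
    have := meshRatio_ne_zero hN1 s
    simp only [hS']; field_simp
  have hquad : ∀ s, IsQuad (p' s) (S' s) := fun s => (hp s).isQuad.comp_homot _ _ _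
  have hvert : ∀ s k, p' s (uniformMesh P N s k) = u (uniformMesh P N s k) := by
    intro s k
    simp only [hp']
    rw [← meshMap_vertex, hcancel, (hp s).vertex]
  have havg : ∀ s i j, volume.real (tri (uniformMesh P N s)) * S' s i j =
      ∫ x in tri (uniformMesh P N s), H i j x := by
    intro s i j
    have hv := setIntegral_uniformMesh hP hN1 s (fun _ => 1)
    simp only [setIntegral_const, smul_eq_mul, mul_one] at hv
    have := (hp s).average i j
    simp only [pullHessian, integral_const_mul] at this
    rw [setIntegral_uniformMesh hP hN1, ← this, hv, hSS]; ring
  set v : UniformIndex N → Plane → ℝ := fun s x => p' s x - q x with hv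
  have hvmem : v ∈ VFM P (uniformMesh P N) :=
    interpolant_sub_mem_VFM hP hN1 h hquad hvert havg hq hqu
  have hvquad := fun s => (hquad s).sub hq
  have hsplit := energy_split hP hN1 h havg R
  rw [← brokenSeminormSq_of_isQuad (T := uniformMesh P N) hvquad] at hsplit
  obtain ⟨s, y, hy, rfl⟩ := exists_meshMap_eq hP hN1 hx
  have hE : energy P (pullHessian P N s H) (S s) / (1 / (N : ℝ)) ^ 2 =
      energy (uniformMesh P N s) H (S' s) := by
    rw [div_eq_iff (by positivity)]
    unfold energy
    rw [Finset.sum_mul]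
    refine Finset.sum_congr rfl fun i _ => ?_
    rw [Finset.sum_mul]
    refine Finset.sum_congr rfl fun j _ => ?_
    rw [hSS, setIntegral_pullHessian hP hN1, meshRatio_sq, mul_comm]
  have hZ := brokenSeminormSq_nonneg (uniformMesh P N) v
  -- Of the element errors, only that of the element containing the point is needed; the others are
  -- nonnegative and dropped.
  have hle : energy P (pullHessian P N s H) (S s) / (1 / (N : ℝ)) ^ 2 +
      brokenSeminormSq (uniformMesh P N) v ≤ energy P H R := by
    rw [hE, hsplit]
    gcongr
    exact Finset.single_le_sum (f := fun s => energy (uniformMesh P N s) H (S' s))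
      (fun s _ => energy_nonneg _ _ _) (Finset.mem_univ s)
  have hn1 : (1 / (N : ℝ)) ^ 2 < 1 := by
    rw [div_pow, one_pow, div_lt_one (by positivity)]; nlinarith
  have hvx : |v s (meshMap P N s y)| ≤
      √(brokenSeminormSq (uniformMesh P N) v / lamH P (uniformMesh P N)) := by
    have hmem : meshMap P N s y ∈ tri (uniformMesh P N s) := by
      rw [tri_uniformMesh hP hN1]; exact mem_image_of_mem _ hy
    refine (abs_le_brokenLinftyNorm (fun t => ?_) (fun t => (hvquad t).continuous) s hmem).trans ?_
    · rw [uniformMesh_eq]; exact nondeg_homot _ _ (meshRatio_ne_zero hN1 t) hP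
    · apply Real.le_sqrt_of_sq_le
      rw [le_div_iff₀ hlam, mul_comm]
      exact lamH_mul_le hvmem
  have hc := hchild s _ _ (hp s) y hy
  have htri : |u (meshMap P N s y) - q (meshMap P N s y)| ≤
      |u (meshMap P N s y) - p s y| + |v s (meshMap P N s y)| := by
    have : u (meshMap P N s y) - q (meshMap P N s y) =
        (u (meshMap P N s y) - p s y) + v s (meshMap P N s y) := by
      simp only [hv, hp', hcancel]; ring
    rw [this]; exact abs_add_le _ _
  have hmain := add_sqrt_le (n := (1 / (N : ℝ)) ^ 2) (by positivity) hn1 hlam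
    (energy_nonneg P (pullHessian P N s H) (S s)) hZ
  have hmono : √(1 / (lamH P (uniformMesh P N) * (1 - (1 / (N : ℝ)) ^ 2)) *
      (energy P (pullHessian P N s H) (S s) / (1 / (N : ℝ)) ^ 2 +
      brokenSeminormSq (uniformMesh P N) v)) ≤
      √(1 / (lamH P (uniformMesh P N) * (1 - (1 / (N : ℝ)) ^ 2)) * energy P H R) := by
    apply Real.sqrt_le_sqrt
    have : 0 ≤ 1 - (1 / (N : ℝ)) ^ 2 := by linarith
    gcongr
  linarith

/-- `k` refinement steps. -/
theorem abs_sub_interpolant_le (hP : Nondeg P) (hN : 2 ≤ N)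
    (hlam : 0 < lamH P (uniformMesh P N)) {C D δ : ℝ} (hD : ∀ x ∈ tri P, ∀ y ∈ tri P, dist x y ≤ D)
    (hC : ∀ u H q S, HasHessian (tri P) u H → IsInterpolant P u H q S → ∀ ε,
      (∀ x ∈ tri P, ∀ y ∈ tri P, |u x - u y| ≤ ε) → ∀ x ∈ tri P,
      |u x - q x| ≤ ε + C * √(energy P H (fun _ _ => 0))) (hC0 : 0 ≤ C) (k : ℕ) :
    ∀ u H q S, HasHessian (tri P) u H → IsInterpolant P u H q S →
      (∀ x ∈ tri P, ∀ y ∈ tri P, dist x y ≤ (1 / (N : ℝ)) ^ k * D → |u x - u y| ≤ δ) →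
      (1 / (N : ℝ)) ^ k * (C * √(energy P H (fun _ _ => 0))) ≤ δ → ∀ x ∈ tri P,
      |u x - q x| ≤ √(1 / (lamH P (uniformMesh P N) * (1 - (1 / (N : ℝ)) ^ 2)) *
        energy P H S) + 2 * δ := by
  have hN1 : 1 ≤ N := by omega
  -- All functions are treated at once, because a step passes from `u` to its pullbacks. At `k = 0`
  -- the crude estimate gives `δ` from the oscillation and `δ` from the energy, whence `2 * δ`.
  induction k with
  | zero =>
    intro u H q S h hq hosc hE x hx
    simp only [pow_zero, one_mul] at hosc hE
    have h1 := hC u H q S h hq δ (fun x hx y hy => hosc x hx y hy (hD x hx y hy)) x hx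
    have h2 := Real.sqrt_nonneg (1 / (lamH P (uniformMesh P N) * (1 - (1 / (N : ℝ)) ^ 2)) *
        energy P H S)
    linarith
  | succ k ih =>
    intro u H q S h hq hosc hE x hx
    refine abs_sub_le_of_children hP hN hlam h hq.isQuad hq.vertex (fun s p S' hp => ?_) hx
    refine ih _ _ p S' (h.pull hP hN1 s) hp (fun x hx y hy hxy => ?_) ?_
    · refine hosc _ (meshMap_mem hP hN1 s hx) _ (meshMap_mem hP hN1 s hy) ?_
      rw [meshMap_dist, pow_succ']
      rw [mul_assoc]
      exact mul_le_mul_of_nonneg_left hxy (by positivity)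
    · refine le_trans ?_ hE
      have h1 := sqrt_energy_pullHessian_le hP hN1 h s
      calc (1 / (N : ℝ)) ^ k * (C * √(energy P (pullHessian P N s H) fun _ _ => 0))
          ≤ (1 / (N : ℝ)) ^ k * (C * (1 / (N : ℝ) * √(energy P H fun _ _ => 0))) := by gcongr
        _ = (1 / (N : ℝ)) ^ (k + 1) * (C * √(energy P H fun _ _ => 0)) := by ring

/-- The discrete eigenvalue bounds the point values of a function with vanishing vertex values. -/
theorem abs_le_sqrt_energy (hP : Nondeg P) (hN : 2 ≤ N) (hlam : 0 < lamH P (uniformMesh P N))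
    (h : HasHessian (tri P) u H) (hu : ∀ k, u (P k) = 0) {x : Plane} (hx : x ∈ tri P) :
    |u x| ≤ √(1 / (lamH P (uniformMesh P N) * (1 - (1 / (N : ℝ)) ^ 2)) *
      energy P H (fun _ _ => 0)) := by
  have hN1 : 1 ≤ N := by omega
  have hN' : (2 : ℝ) ≤ N := by exact_mod_cast hN
  obtain ⟨ρ, hρ⟩ := (isCompact_tri P).exists_bound_of_continuousOn (f := fun x : Plane => x)
    continuousOn_id
  have hρ' : ∀ x ∈ tri P, ∀ i, |x i| ≤ ρ := fun x hx i =>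
    (PiLp.norm_apply_le x i).trans (hρ x hx)
  have hC : ∀ u H q S, HasHessian (tri P) u H → IsInterpolant P u H q S → ∀ ε,
      (∀ x ∈ tri P, ∀ y ∈ tri P, |u x - u y| ≤ ε) → ∀ x ∈ tri P,
      |u x - q x| ≤ ε + (4 * ρ ^ 2 / √(volume.real (tri P))) * √(energy P H (fun _ _ => 0)) := by
    intro u H q S h hq ε hε x hx
    refine (abs_sub_le_of_oscillation hP hq.isQuad hq.vertex hε
      (fun i j => hq.abs_hessian_le hP h i j) hρ' hx).trans (le_of_eq ?_)
    rw [Real.sqrt_div (energy_nonneg _ _ _)]; ring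
  set C := 4 * ρ ^ 2 / √(volume.real (tri P)) with hCdef
  have hC0 : 0 ≤ C := by positivity
  set D := Metric.diam (tri P)
  have hD : ∀ x ∈ tri P, ∀ y ∈ tri P, dist x y ≤ D := fun x hx y hy =>
    Metric.dist_le_diam_of_mem (isCompact_tri P).isBounded hx hy
  refine le_of_forall_pos_le_add fun ε hε => ?_
  obtain ⟨η, hη, hunif⟩ := Metric.uniformContinuousOn_iff.1
    ((isCompact_tri P).uniformContinuousOn_of_continuous h.continuousOn) (ε / 2) (by positivity)
  have hlim : ∀ c : ℝ, Filter.Tendsto (fun k : ℕ => (1 / (N : ℝ)) ^ (k + 1) * c) Filter.atTop (nhds 0) := by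
    intro c
    have h1 : Filter.Tendsto (fun k : ℕ => (1 / (N : ℝ)) ^ k) Filter.atTop (nhds 0) :=
      tendsto_pow_atTop_nhds_zero_of_lt_one (by positivity)
        (by rw [div_lt_one (by positivity)]; linarith)
    simpa using ((Filter.tendsto_add_atTop_iff_nat 1).2 h1).mul_const c
  -- The exponent is `k + 1` because one refinement is spent at the top level before the `k` steps
  -- for the pullbacks.
  obtain ⟨k, hk1, hk2⟩ := (((hlim D).eventually (gt_mem_nhds hη)).and
    ((hlim (C * √(energy P H (fun _ _ => 0)))).eventually (gt_mem_nhds (half_pos hε)))).exists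
  obtain ⟨δ, hδ⟩ : ∃ δ, δ = ε / 2 := ⟨_, rfl⟩
  -- The comparison function at the top level is `0`. It has the right vertex values but in general
  -- not the mean Hessian, so it need not be the interpolant.
  have hstep := abs_sub_le_of_children (δ := 2 * δ) hP hN hlam h isQuad_zero
    (fun k => (hu k).symm) (fun s p S hp => ?_) hx
  · rw [sub_zero] at hstep; linarith
  refine abs_sub_interpolant_le hP hN hlam hD hC hC0 k _ _ p S (h.pull hP hN1 s) hp
    (fun x hx y hy hxy => ?_) ?_
  · rw [hδ, ← Real.dist_eq]
    refine (hunif _ (meshMap_mem hP hN1 s hx) _ (meshMap_mem hP hN1 s hy) ?_).le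
    rw [meshMap_dist]
    refine lt_of_le_of_lt ?_ hk1
    rw [pow_succ', mul_assoc]
    exact mul_le_mul_of_nonneg_left hxy (by positivity)
  · rw [hδ]
    refine le_trans ?_ hk2.le
    have h1 := sqrt_energy_pullHessian_le hP hN1 h s
    calc (1 / (N : ℝ)) ^ k * (C * √(energy P (pullHessian P N s H) fun _ _ => 0))
        ≤ (1 / (N : ℝ)) ^ k * (C * (1 / (N : ℝ) * √(energy P H fun _ _ => 0))) := by gcongr
      _ = (1 / (N : ℝ)) ^ (k + 1) * (C * √(energy P H fun _ _ => 0)) := by ring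

end Pullback

end FujinoMorley

/-! ### From weak derivatives to second differences -/

namespace FujinoMorley

open Filter Topology Pointwise

/-! ### Weak derivatives -/

theorem integrable_mul_of_tsupport_subset {U : Set Plane} {v φ : Plane → ℝ}
    (hv : LocallyIntegrableOn v U) (hφ : Continuous φ) (hc : HasCompactSupport φ)
    (hs : tsupport φ ⊆ U) : Integrable (fun x => v x * φ x) := by
  have h1 : IntegrableOn (fun x => v x * φ x) (tsupport φ) :=
    (hv.integrableOn_compact_subset hs hc).mul_continuousOn hφ.continuousOn hc
  refine (integrableOn_iff_integrable_of_support_subset ?_).1 h1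
  exact (Function.support_mul_subset_right _ _).trans (subset_tsupport φ)

theorem setIntegral_mul_of_tsupport_subset {U : Set Plane} {φ : Plane → ℝ} (hs : tsupport φ ⊆ U)
    (v : Plane → ℝ) : ∫ x in U, v x * φ x = ∫ x, v x * φ x :=
  setIntegral_eq_integral_of_forall_compl_eq_zero fun x hx => by
    rw [image_eq_zero_of_notMem_tsupport (fun h => hx (hs h)), mul_zero]

theorem IsWeakPartial.ae_eq {U : Set Plane} (hU : IsOpen U) {i : Fin 2} {u v w : Plane → ℝ}
    (hv : IsWeakPartial U i u v) (hw : IsWeakPartial U i u w) : v =ᵐ[volume.restrict U] w := by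
  have h := hU.ae_eq_zero_of_integral_contDiff_smul_eq_zero (μ := volume) (hv.1.sub hw.1)
    (fun φ h1 h2 h3 => by
      have e1 := hv.2 φ h1 h2 h3
      have e2 := hw.2 φ h1 h2 h3
      rw [e1, neg_inj, setIntegral_mul_of_tsupport_subset h3,
        setIntegral_mul_of_tsupport_subset h3] at e2
      simp only [Pi.sub_apply, smul_eq_mul, mul_comm (φ _), sub_mul]
      rw [integral_sub (integrable_mul_of_tsupport_subset hv.1 h1.continuous h2 h3)
        (integrable_mul_of_tsupport_subset hw.1 h1.continuous h2 h3), e2, sub_self])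
  rw [EventuallyEq, ae_restrict_iff' hU.measurableSet]
  filter_upwards [h] with x hx hxU
  exact sub_eq_zero.1 (hx hxU)

theorem IsWeakPartial.congr {U : Set Plane} {i : Fin 2} {u u' v : Plane → ℝ}
    (h : IsWeakPartial U i u v) (hu : u =ᵐ[volume.restrict U] u') : IsWeakPartial U i u' v := by
  refine ⟨h.1, fun φ h1 h2 h3 => ?_⟩
  rw [← h.2 φ h1 h2 h3]
  exact integral_congr_ae (by filter_upwards [hu] with x hx; rw [hx])

theorem isWeakPartial_weakPartial {U : Set Plane} {i : Fin 2} {u v : Plane → ℝ}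
    (h : IsWeakPartial U i u v) : IsWeakPartial U i u (weakPartial U i u) := by
  have hex : ∃ v, IsWeakPartial U i u v := ⟨v, h⟩
  rw [weakPartial, dif_pos hex]
  exact hex.choose_spec

theorem partialDeriv_contDiff {φ : Plane → ℝ} (h : ContDiff ℝ ∞ φ) (i : Fin 2) :
    ContDiff ℝ ∞ (partialDeriv i φ) :=
  (h.fderiv_right (m := ∞) (by norm_cast)).clm_apply contDiff_const

theorem partialDeriv_hasCompactSupport {φ : Plane → ℝ} (h : HasCompactSupport φ) (i : Fin 2) :
    HasCompactSupport (partialDeriv i φ) := h.fderiv_apply ℝ _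

theorem partialDeriv_tsupport (φ : Plane → ℝ) (i : Fin 2) :
    tsupport (partialDeriv i φ) ⊆ tsupport φ := tsupport_fderiv_apply_subset ℝ _

/-- The second weak derivatives of a function in `H²`. -/
theorem MemH2.hessian {U : Set Plane} (hU : IsOpen U) {u : Plane → ℝ} (hu : MemH2 U u) :
    ∀ i j, MemLp (weakPartial U j (weakPartial U i u)) 2 (volume.restrict U) ∧
      ∀ φ : Plane → ℝ, ContDiff ℝ ∞ φ → HasCompactSupport φ → tsupport φ ⊆ U →
        ∫ x in U, u x * partialDeriv i (partialDeriv j φ) x =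
          ∫ x in U, weakPartial U j (weakPartial U i u) x * φ x := by
  obtain ⟨-, g, H, hg, hH⟩ := hu
  intro i j
  have h1 := isWeakPartial_weakPartial (hg i).1
  -- The outer weak derivative is taken of the chosen version of the inner one, which agrees with `g
  -- i` only almost everywhere.
  have h2 := (hH i j).1.congr ((hg i).1.ae_eq hU h1)
  have h3 := isWeakPartial_weakPartial h2
  refine ⟨(memLp_congr_ae (h2.ae_eq hU h3)).1 (hH i j).2, fun φ p1 p2 p3 => ?_⟩
  rw [h1.2 _ (partialDeriv_contDiff p1 j) (partialDeriv_hasCompactSupport p2 j)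
    ((partialDeriv_tsupport φ j).trans p3), h3.2 φ p1 p2 p3, neg_neg]

/-! ### Smeared test functions -/

/-- The average of the translates of `f` by the points of `Q` (not normalized). -/
noncomputable def smear (Q : Set Plane) (f : Plane → ℝ) : Plane → ℝ :=
  convolution f (Q.indicator fun _ => (1 : ℝ)) (ContinuousLinearMap.lsmul ℝ ℝ) volume

section Smear

variable {Q : Set Plane} {f : Plane → ℝ}

theorem locallyIntegrable_indicator_one (hQ : IsCompact Q) :
    LocallyIntegrable (Q.indicator fun _ => (1 : ℝ)) :=
  ((integrable_indicator_iff hQ.isClosed.measurableSet).2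
    (integrableOn_const hQ.measure_lt_top.ne)).locallyIntegrable

theorem smear_apply (hQ : IsCompact Q) (f : Plane → ℝ) (x : Plane) :
    smear Q f x = ∫ y in Q, f (x - y) := by
  rw [smear, convolution_eq_swap, ← integral_indicator hQ.isClosed.measurableSet]
  refine integral_congr_ae (.of_forall fun y => ?_)
  by_cases hy : y ∈ Q <;> simp [hy]

theorem smear_contDiff (hQ : IsCompact Q) (hf : ContDiff ℝ ∞ f) (hc : HasCompactSupport f) :
    ContDiff ℝ ∞ (smear Q f) := by
  have := hc.contDiff_convolution_left (n := (⊤ : ℕ∞)) (ContinuousLinearMap.lsmul ℝ ℝ)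
    (μ := (volume : Measure Plane)) hf (locallyIntegrable_indicator_one hQ)
  exact this

theorem smear_support (Q : Set Plane) (f : Plane → ℝ) :
    Function.support (smear Q f) ⊆ Function.support f + Q := by
  refine (support_convolution_subset (L := ContinuousLinearMap.lsmul ℝ ℝ)).trans ?_
  exact add_subset_add_left (support_indicator_subset)

theorem partialDeriv_smear (hQ : IsCompact Q) (hf : ContDiff ℝ ∞ f) (hc : HasCompactSupport f)
    (i : Fin 2) : partialDeriv i (smear Q f) = smear Q (partialDeriv i f) := by
  funext x
  have hf1 : ContDiff ℝ 1 f := hf.of_le (by norm_cast)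
  have h := hc.hasFDerivAt_convolution_left (ContinuousLinearMap.lsmul ℝ ℝ)
    (μ := (volume : Measure Plane)) hf1 (locallyIntegrable_indicator_one hQ) x
  have hf' : Continuous (fderiv ℝ f) := hf1.continuous_fderiv one_ne_zero
  have hex : ConvolutionExistsAt (fderiv ℝ f) (Q.indicator fun _ => (1 : ℝ)) x
      ((ContinuousLinearMap.lsmul ℝ ℝ).precompL Plane) volume :=
    (hc.fderiv ℝ).convolutionExists_left _ hf' (locallyIntegrable_indicator_one hQ) x
  unfold smear partialDeriv
  rw [h.fderiv, convolution_def, ContinuousLinearMap.integral_apply hex]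
  rfl

end Smear

theorem integral_fderiv_sub_smul {f : Plane → ℝ} (hf : ContDiff ℝ ∞ f) (z b : Plane) :
    ∫ t in (0:ℝ)..1, fderiv ℝ f (z - t • b) b = f z - f (z - b) := by
  have hd : ∀ t ∈ uIcc (0:ℝ) 1, HasDerivAt (fun t : ℝ => -f (z - t • b))
      (fderiv ℝ f (z - t • b) b) t := by
    intro t _
    have h1 : HasDerivAt (fun t : ℝ => z - t • b) (-b) t := by
      simpa using ((hasDerivAt_id t).smul_const b).const_sub z
    have h2 := ((hf.differentiable (by simp)) (z - t • b)).hasFDerivAt.comp_hasDerivAt t h1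
    have h3 := h2.neg
    rw [map_neg, neg_neg] at h3
    exact h3
  have hcont : Continuous fun t : ℝ => fderiv ℝ f (z - t • b) b := by
    have : Continuous (fderiv ℝ f) := hf.continuous_fderiv (by simp)
    fun_prop
  rw [intervalIntegral.integral_eq_sub_of_hasDerivAt hd (hcont.intervalIntegrable _ _)]
  simp; ring

theorem para_comm (c a b : Plane) : para c a b = para c b a := by
  have : ∀ a b : Plane, para c a b ⊆ para c b a := by
    rintro a b _ ⟨s, hs, t, ht, rfl⟩
    exact ⟨t, ht, s, hs, by abel⟩
  exact (this a b).antisymm (this b a)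

theorem fderiv_eq_sum_partialDeriv (f : Plane → ℝ) (x v : Plane) :
    fderiv ℝ f x v = v 0 * partialDeriv 0 f x + v 1 * partialDeriv 1 f x := by
  have hv : v = v 0 • EuclideanSpace.single (0 : Fin 2) (1:ℝ) +
      v 1 • EuclideanSpace.single (1 : Fin 2) (1:ℝ) := by
    apply plane_ext <;> simp
  conv_lhs => rw [hv]
  simp only [map_add, map_smul, smul_eq_mul, partialDeriv]

theorem integral_bil {μ : Measure Plane} {F : Fin 2 → Fin 2 → Plane → ℝ}
    (hF : ∀ i j, Integrable (F i j) μ) (a b : Plane) :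
    ∫ x, bil (fun i j => F i j x) a b ∂μ = bil (fun i j => ∫ x, F i j x ∂μ) a b := by
  have h : ∀ i j, Integrable (fun x => F i j x * a i * b j) μ :=
    fun i j => ((hF i j).mul_const _).mul_const _
  have h2 : Integrable (fun x => F 0 0 x * a 0 * b 0 + F 0 1 x * a 0 * b 1) μ :=
    (h 0 0).add (h 0 1)
  have h3 : Integrable (fun x => F 0 0 x * a 0 * b 0 + F 0 1 x * a 0 * b 1 +
    F 1 0 x * a 1 * b 0) μ := h2.add (h 1 0)
  unfold bil
  rw [integral_add h3 (h 1 1), integral_add h2 (h 1 0), integral_add (h 0 0) (h 0 1)]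
  simp only [integral_mul_const]

/-- The second derivative of a function smeared over a parallelogram is a second difference. -/
theorem bil_partialDeriv_smear {c a b : Plane} (hab : det2 a b ≠ 0) {φ : Plane → ℝ}
    (hφ : ContDiff ℝ ∞ φ) (hc : HasCompactSupport φ) (x : Plane) :
    bil (fun i j => partialDeriv i (partialDeriv j (smear (para c a b) φ)) x) a b =
      volume.real (para c a b) * (φ (x - c) - φ (x - (c + a)) - φ (x - (c + b)) +
        φ (x - (c + a + b))) := by
  have hQ := isCompact_para c a b
  have hint : ∀ i j, IntegrableOn (fun y => partialDeriv i (partialDeriv j φ) (x - y))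
      (para c a b) := fun i j =>
    ((partialDeriv_contDiff (partialDeriv_contDiff hφ j) i).continuous.comp
      (continuous_const.sub continuous_id)).continuousOn.integrableOn_compact hQ
  have hab' : det2 b a ≠ 0 := by
    have : det2 b a = -det2 a b := by simp [det2]; ring
    rw [this]; exact neg_ne_zero.2 hab
  set ψ : Plane → ℝ := fun y => fderiv ℝ φ y b with hψ
  have hψs : ContDiff ℝ ∞ ψ := (hφ.fderiv_right (m := ∞) (by norm_cast)).clm_apply contDiff_const
  have hψ2 : ∀ z, fderiv ℝ ψ z a = bil (fun i j => partialDeriv i (partialDeriv j φ) z) a b := by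
    intro z
    have hd : ∀ j, DifferentiableAt ℝ (partialDeriv j φ) z := fun j =>
      (partialDeriv_contDiff hφ j).differentiable (by simp) z
    have e : ψ = fun y => b 0 * partialDeriv 0 φ y + b 1 * partialDeriv 1 φ y :=
      funext fun y => fderiv_eq_sum_partialDeriv φ y b
    rw [e, fderiv_fun_add ((hd 0).const_mul _) ((hd 1).const_mul _), fderiv_const_mul (hd 0),
      fderiv_const_mul (hd 1)]
    simp only [add_apply, smul_apply, smul_eq_mul,
      fderiv_eq_sum_partialDeriv, bil]
    ring
  have hψa : Continuous fun z => fderiv ℝ ψ z a := by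
    have : Continuous (fderiv ℝ ψ) := hψs.continuous_fderiv (by simp)
    fun_prop
  have e1 : bil (fun i j => partialDeriv i (partialDeriv j (smear (para c a b) φ)) x) a b =
      ∫ y in para c a b, fderiv ℝ ψ (x - y) a := by
    have h : ∀ i j, partialDeriv i (partialDeriv j (smear (para c a b) φ)) x =
        ∫ y in para c a b, partialDeriv i (partialDeriv j φ) (x - y) := by
      intro i j
      rw [partialDeriv_smear hQ hφ hc, partialDeriv_smear hQ (partialDeriv_contDiff hφ j)
        (partialDeriv_hasCompactSupport hc j), smear_apply hQ]
    simp only [h, hψ2]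
    exact (integral_bil hint a b).symm
  -- The inner integral runs in direction `a`, so the fundamental theorem of calculus removes the
  -- `a`-derivative first and the `b`-derivative second.
  rw [e1, para_comm, integral_para hab' (f := fun y => fderiv ℝ ψ (x - y) a)
    (hψa.comp (continuous_const.sub continuous_id))]
  congr 1
  have e2 : ∀ s t : ℝ, x - (c + s • b + t • a) = (x - c - s • b) - t • a := by
    intro s t; abel
  simp only [e2, integral_fderiv_sub_smul hψs]
  have hψc := hψs.continuous
  rw [intervalIntegral.integral_sub (Continuous.intervalIntegrable (by fun_prop) _ _)
    (Continuous.intervalIntegrable (by fun_prop) _ _)]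
  have e3 : ∀ s : ℝ, x - c - s • b - a = x - (c + a) - s • b := by intro s; abel
  simp only [e3, hψ, integral_fderiv_sub_smul hφ]
  have e4 : x - c - b = x - (c + b) := by abel
  have e5 : x - (c + a) - b = x - (c + a + b) := by abel
  rw [e4, e5]; ring

/-! ### The second difference identity for functions in `H²` -/

/-- Smearing a bump over `Q` mollifies the indicator of `Q`, which is continuous off the frontier.
-/
theorem tendsto_smear_bump {φ : ℕ → ContDiffBump (0 : Plane)}
    (hφ : Tendsto (fun n => (φ n).rOut) atTop (𝓝 0)) {Q : Set Plane} (hQ : IsCompact Q) {x : Plane}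
    (hx : x ∉ frontier Q) : Tendsto (fun n => smear Q ((φ n).normed volume) x) atTop
      (𝓝 (Q.indicator (fun _ => (1 : ℝ)) x)) := by
  refine ContDiffBump.convolution_tendsto_right hφ
    (.of_forall fun _ => (locallyIntegrable_indicator_one hQ).aestronglyMeasurable) ?_
    tendsto_const_nhds
  have hcont : ContinuousAt (Q.indicator fun _ => (1 : ℝ)) x := by
    by_cases hxi : x ∈ interior Q
    · refine (continuousAt_const (y := (1:ℝ))).congr ?_
      filter_upwards [mem_interior_iff_mem_nhds.1 hxi] with y hy
      simp [hy]
    · have hxc : x ∈ Qᶜ := fun h => hx ⟨subset_closure h, hxi⟩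
      refine (continuousAt_const (y := (0:ℝ))).congr ?_
      filter_upwards [hQ.isClosed.isOpen_compl.mem_nhds hxc] with y hy
      simp [notMem_of_mem_compl hy]
  exact hcont.tendsto.comp tendsto_snd

theorem abs_smear_bump_le (φ : ContDiffBump (0 : Plane)) {Q : Set Plane} (hQ : IsCompact Q)
    (x : Plane) : |smear Q (φ.normed volume) x| ≤ 1 := by
  rw [smear_apply hQ, abs_of_nonneg (integral_nonneg fun y => φ.nonneg_normed _)]
  have hint : Integrable (fun y => φ.normed volume (x - y)) := by
    exact φ.integrable_normed.comp_sub_left x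
  refine (setIntegral_le_integral hint (.of_forall fun y => φ.nonneg_normed _)).trans ?_
  rw [integral_sub_left_eq_self (fun y => φ.normed volume y), φ.integral_normed]

theorem tendsto_integral_bump {φ : ℕ → ContDiffBump (0 : Plane)}
    (hφ : Tendsto (fun n => (φ n).rOut) atTop (𝓝 0)) {U : Set Plane} (hU : IsOpen U)
    {u : Plane → ℝ} (hu : ContinuousOn u U) {p : Plane} (hp : p ∈ U) :
    Tendsto (fun n => ∫ x in U, u x * (φ n).normed volume (x - p)) atTop (𝓝 (u p)) := by
  have hmeas : AEStronglyMeasurable (U.indicator u) volume :=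
    (aestronglyMeasurable_indicator_iff hU.measurableSet).2
      (hu.aestronglyMeasurable hU.measurableSet)
  have hcont : ContinuousAt (U.indicator u) p := by
    refine (hu.continuousAt (hU.mem_nhds hp)).congr ?_
    filter_upwards [hU.mem_nhds hp] with y hy
    simp [hy]
  have h := ContDiffBump.convolution_tendsto_right (μ := (volume : Measure Plane)) hφ
    (g := fun _ => U.indicator u) (k := fun _ => p) (x₀ := p) (z₀ := u p)
    (.of_forall fun _ => hmeas) (by
      have := hcont.tendsto.comp (tendsto_snd (f := (atTop : Filter ℕ)) (g := 𝓝 p))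
      rwa [indicator_of_mem hp] at this) tendsto_const_nhds
  refine h.congr fun n => ?_
  rw [convolution_eq_swap, ← integral_indicator hU.measurableSet]
  refine integral_congr_ae (.of_forall fun y => ?_)
  by_cases hy : y ∈ U
  · simp only [hy, indicator_of_mem, ContinuousLinearMap.lsmul_apply, smul_eq_mul]
    -- The bump is even, so the integral is a convolution evaluated at `p`.
    rw [← (φ n).normed_neg, neg_sub, mul_comm]
  · simp [hy]

/-- The second difference identity on parallelograms inside an open set. -/
theorem second_difference_of_weak {U : Set Plane} (hU : IsOpen U) {u : Plane → ℝ}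
    (hu : ContinuousOn u U) (hui : IntegrableOn u U) {H : Fin 2 → Fin 2 → Plane → ℝ} (hH : ∀ i j, IntegrableOn (H i j) U)
    (hw : ∀ i j, ∀ φ : Plane → ℝ, ContDiff ℝ ∞ φ → HasCompactSupport φ → tsupport φ ⊆ U →
      ∫ x in U, u x * partialDeriv i (partialDeriv j φ) x = ∫ x in U, H i j x * φ x)
    {c a b : Plane} (hab : det2 a b ≠ 0) (hc : para c a b ⊆ U) :
    volume.real (para c a b) * (u c - u (c + a) - u (c + b) + u (c + a + b)) =
      bil (fun i j => ∫ x in para c a b, H i j x) a b := by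
  set Q := para c a b with hQdef
  have hQ : IsCompact Q := isCompact_para c a b
  -- The bump radii stay at most `ε`, which keeps the supports of the smeared test functions inside
  -- `U`.
  obtain ⟨ε, hε, hεU⟩ := hQ.exists_cthickening_subset_open hU hc
  let φ : ℕ → ContDiffBump (0 : Plane) := fun n =>
    ⟨ε / (n + 1) / 2, ε / (n + 1), by positivity, half_lt_self (by positivity)⟩
  have hφ : Tendsto (fun n => (φ n).rOut) atTop (𝓝 0) := by
    have := (tendsto_one_div_add_atTop_nhds_zero_nat (𝕜 := ℝ)).const_mul ε
    simpa [φ, div_eq_mul_inv] using this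
  have hφε : ∀ n, (φ n).rOut ≤ ε := fun n => by
    change ε / ((n : ℝ) + 1) ≤ ε
    exact div_le_self hε.le (by linarith [(Nat.cast_nonneg n : (0:ℝ) ≤ n)])
  set ρ : ℕ → Plane → ℝ := fun n => (φ n).normed volume with hρ
  have hρs : ∀ n, ContDiff ℝ ∞ (ρ n) := fun n => (φ n).contDiff_normed
  have hρc : ∀ n, HasCompactSupport (ρ n) := fun n => (φ n).hasCompactSupport_normed
  have hsupp : ∀ n, tsupport (smear Q (ρ n)) ⊆ Metric.cthickening ε Q := by
    intro n
    refine closure_minimal ((smear_support Q (ρ n)).trans ?_) Metric.isClosed_cthickening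
    rintro _ ⟨y, hy, z, hz, rfl⟩
    refine Metric.mem_cthickening_of_dist_le _ z ε Q hz ?_
    have : y ∈ Metric.ball (0 : Plane) (φ n).rOut := by
      rw [← (φ n).support_normed_eq (μ := volume)]; exact hy
    simp only [dist_eq_norm, add_sub_cancel_right]
    exact (mem_ball_zero_iff.1 this).le.trans (hφε n)
  have htest : ∀ n, ContDiff ℝ ∞ (smear Q (ρ n)) ∧ HasCompactSupport (smear Q (ρ n)) ∧
      tsupport (smear Q (ρ n)) ⊆ U := fun n =>
    ⟨smear_contDiff hQ (hρs n) (hρc n),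
      hQ.cthickening.of_isClosed_subset (isClosed_tsupport _) (hsupp n), (hsupp n).trans hεU⟩
  have hpt : ∀ s ∈ Icc (0:ℝ) 1, ∀ t ∈ Icc (0:ℝ) 1, c + s • a + t • b ∈ U :=
    fun s hs t ht => hc ⟨s, hs, t, ht, rfl⟩
  have p00 : c ∈ U := by simpa using hpt 0 (by simp) 0 (by simp)
  have p10 : c + a ∈ U := by simpa using hpt 1 (by simp) 0 (by simp)
  have p01 : c + b ∈ U := by simpa using hpt 0 (by simp) 1 (by simp)
  have p11 : c + a + b ∈ U := by simpa using hpt 1 (by simp) 1 (by simp)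
  have huloc : LocallyIntegrableOn u U := hui.locallyIntegrableOn
  -- Contracted with `a` and `b`, the second derivatives of the test function form a second
  -- difference of the bump. In the limit this side yields point values of `u`, and the other side
  -- integrals of `H` over `Q`.
  have key : ∀ n, volume.real Q * ((∫ x in U, u x * ρ n (x - c)) -
      (∫ x in U, u x * ρ n (x - (c + a))) - (∫ x in U, u x * ρ n (x - (c + b))) +
      ∫ x in U, u x * ρ n (x - (c + a + b))) =
      bil (fun i j => ∫ x in U, H i j x * smear Q (ρ n) x) a b := by
    intro n
    obtain ⟨t1, t2, t3⟩ := htest n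
    have hint : ∀ i j, IntegrableOn (fun x => u x * partialDeriv i (partialDeriv j
        (smear Q (ρ n))) x) U := fun i j =>
      (integrable_mul_of_tsupport_subset huloc
        (partialDeriv_contDiff (partialDeriv_contDiff t1 j) i).continuous
        (partialDeriv_hasCompactSupport (partialDeriv_hasCompactSupport t2 j) i)
        ((partialDeriv_tsupport _ i).trans ((partialDeriv_tsupport _ j).trans t3))).integrableOn
    have hρi : ∀ p, IntegrableOn (fun x => u x * ρ n (x - p)) U := by
      intro p
      obtain ⟨M, hM⟩ := (hρs n).continuous.bounded_above_of_compact_support (hρc n)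
      exact Integrable.mul_bdd (c := M) hui ((hρs n).continuous.comp
        (continuous_id.sub continuous_const)).aestronglyMeasurable (.of_forall fun x => hM _)
    have e1 := integral_bil hint a b
    simp only [hw _ _ _ t1 t2 t3] at e1
    rw [← e1]
    have e2 : ∀ x, bil (fun i j => u x * partialDeriv i (partialDeriv j (smear Q (ρ n))) x) a b =
        volume.real Q * (u x * ρ n (x - c) - u x * ρ n (x - (c + a)) - u x * ρ n (x - (c + b)) +
          u x * ρ n (x - (c + a + b))) := by
      intro x
      have := bil_partialDeriv_smear (c := c) hab (hρs n) (hρc n) x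
      rw [← hQdef] at this
      simp only [bil] at this ⊢
      linear_combination u x * this
    have i1 : IntegrableOn (fun x => u x * ρ n (x - c) - u x * ρ n (x - (c + a))) U :=
      (hρi _).sub (hρi _)
    have i2 : IntegrableOn (fun x => u x * ρ n (x - c) - u x * ρ n (x - (c + a)) -
      u x * ρ n (x - (c + b))) U := i1.sub (hρi _)
    simp only [e2]
    rw [integral_const_mul, integral_add i2 (hρi _), integral_sub i1 (hρi _),
      integral_sub (hρi _) (hρi _)]
  have hL : Tendsto (fun n => volume.real Q * ((∫ x in U, u x * ρ n (x - c)) -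
      (∫ x in U, u x * ρ n (x - (c + a))) - (∫ x in U, u x * ρ n (x - (c + b))) +
      ∫ x in U, u x * ρ n (x - (c + a + b)))) atTop
      (𝓝 (volume.real Q * (u c - u (c + a) - u (c + b) + u (c + a + b)))) :=
    ((((tendsto_integral_bump hφ hU hu p00).sub (tendsto_integral_bump hφ hU hu p10)).sub
      (tendsto_integral_bump hφ hU hu p01)).add (tendsto_integral_bump hφ hU hu p11)).const_mul _
  have hR1 : ∀ i j, Tendsto (fun n => ∫ x in U, H i j x * smear Q (ρ n) x) atTop
      (𝓝 (∫ x in Q, H i j x)) := by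
    intro i j
    have e : ∫ x in Q, H i j x = ∫ x in U, H i j x * Q.indicator (fun _ => (1:ℝ)) x := by
      have : (fun x => H i j x * Q.indicator (fun _ => (1:ℝ)) x) = Q.indicator (H i j) := by
        funext x; by_cases hx : x ∈ Q <;> simp [hx]
      rw [this, setIntegral_indicator hQ.isClosed.measurableSet, inter_eq_self_of_subset_right hc]
    rw [e]
    refine tendsto_integral_of_dominated_convergence (fun x => |H i j x|)
      (fun n => (hH i j).aestronglyMeasurable.mul (htest n).1.continuous.aestronglyMeasurable)
      (hH i j).abs (fun n => .of_forall fun x => ?_) ?_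
    · rw [Real.norm_eq_abs, abs_mul]
      exact mul_le_of_le_one_right (abs_nonneg _) (abs_smear_bump_le (φ n) hQ x)
    · have hfr : ∀ᵐ x ∂(volume.restrict U), x ∉ frontier Q :=
        ae_restrict_of_ae (measure_eq_zero_iff_ae_notMem.1
          ((convex_para c a b).addHaar_frontier volume))
      filter_upwards [hfr] with x hx
      exact (tendsto_smear_bump hφ hQ hx).const_mul _
  have hR : Tendsto (fun n => bil (fun i j => ∫ x in U, H i j x * smear Q (ρ n) x) a b) atTop
      (𝓝 (bil (fun i j => ∫ x in Q, H i j x) a b)) := by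
    unfold bil
    exact (((((hR1 0 0).mul_const _).mul_const _).add (((hR1 0 1).mul_const _).mul_const _)).add
      (((hR1 1 0).mul_const _).mul_const _)).add (((hR1 1 1).mul_const _).mul_const _)
  exact tendsto_nhds_unique (hL.congr key) hR

end FujinoMorley

/-! ### Extension to the closed triangle and nonemptiness of the function space -/

namespace FujinoMorley

open Filter Topology Pointwise

theorem homot_self_continuousAt (z x : Plane) :
    Tendsto (fun r : ℝ => homot z z r⁻¹ x) (𝓝 1) (𝓝 x) := by
  have h : ContinuousAt (fun r : ℝ => homot z z r⁻¹ x) 1 := by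
    unfold homot
    exact continuousAt_const.add
      (((continuousAt_inv₀ one_ne_zero).smul continuousAt_const))
  have e : homot z z (1:ℝ)⁻¹ x = x := by simp [homot]
  rw [ContinuousAt, e] at h
  exact h

theorem mem_image_homot_self (z x : Plane) {r : ℝ} (hr : r ≠ 0) (S : Set Plane) :
    x ∈ homot z z r '' S ↔ homot z z r⁻¹ x ∈ S := by
  have h1 : homot z z r (homot z z r⁻¹ x) = x := by
    apply plane_ext <;> simp [homot, hr]
  constructor
  · rintro ⟨y, hy, rfl⟩
    have h2 : homot z z r⁻¹ (homot z z r y) = y := by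
      apply plane_ext <;> simp [homot, hr]
    rwa [h2]
  · intro h; exact ⟨_, h, h1⟩

/-- The second difference identity extends from the interior of a convex set to the set. -/
theorem second_difference_of_interior {K : Set Plane} (hK : Convex ℝ K)
    {z : Plane} (hz : z ∈ interior K) {u : Plane → ℝ} (hu : ContinuousOn u K)
    {H : Fin 2 → Fin 2 → Plane → ℝ} (hH : ∀ i j, IntegrableOn (H i j) K)
    (h : ∀ c a b, det2 a b ≠ 0 → para c a b ⊆ interior K →
      volume.real (para c a b) * (u c - u (c + a) - u (c + b) + u (c + a + b)) =
        bil (fun i j => ∫ x in para c a b, H i j x) a b)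
    {c a b : Plane} (hab : det2 a b ≠ 0) (hc : para c a b ⊆ K) :
    volume.real (para c a b) * (u c - u (c + a) - u (c + b) + u (c + a + b)) =
      bil (fun i j => ∫ x in para c a b, H i j x) a b := by
  set Q := para c a b with hQdef
  have hQ : IsCompact Q := isCompact_para c a b
  -- Contracting towards the interior point `z` with ratio below `1` moves `K` into its interior;
  -- the shift by `2` keeps `r 0` positive.
  set r : ℕ → ℝ := fun n => 1 - 1 / ((n : ℝ) + 2) with hr
  have hrlim : Tendsto r atTop (𝓝 1) := by
    have h1 := (tendsto_add_atTop_iff_nat (f := fun n : ℕ => 1 / (n : ℝ)) 2).2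
      (tendsto_one_div_atTop_nhds_zero_nat (𝕜 := ℝ))
    simpa [r] using h1.const_sub 1
  have hr0 : ∀ n, 0 < r n ∧ r n < 1 := fun n => by
    have hn : (0:ℝ) ≤ n := Nat.cast_nonneg n
    have : (0:ℝ) < n + 2 := by linarith
    constructor
    · simp only [hr, sub_pos, div_lt_one this]; linarith
    · simp only [hr, sub_lt_self_iff]; positivity
  have hmap : ∀ n, ∀ x ∈ K, homot z z (r n) x ∈ interior K := by
    intro n x hx
    refine hK.openSegment_interior_self_subset_interior hz hx
      ⟨1 - r n, r n, by linarith [(hr0 n).2], (hr0 n).1, by ring, ?_⟩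
    apply plane_ext <;> simp [homot] <;> ring
  have hpt : ∀ s ∈ Icc (0:ℝ) 1, ∀ t ∈ Icc (0:ℝ) 1, c + s • a + t • b ∈ K :=
    fun s hs t ht => hc ⟨s, hs, t, ht, rfl⟩
  have p00 : c ∈ K := by simpa using hpt 0 (by simp) 0 (by simp)
  have p10 : c + a ∈ K := by simpa using hpt 1 (by simp) 0 (by simp)
  have p01 : c + b ∈ K := by simpa using hpt 0 (by simp) 1 (by simp)
  have p11 : c + a + b ∈ K := by simpa using hpt 1 (by simp) 1 (by simp)
  have hlim : ∀ p ∈ K, Tendsto (fun n => u (homot z z (r n) p)) atTop (𝓝 (u p)) := by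
    intro p hp
    have h1 : Tendsto (fun n => homot z z (r n) p) atTop (𝓝 p) := by
      have : Tendsto (fun n => z + r n • (p - z)) atTop (𝓝 (z + (1:ℝ) • (p - z))) :=
        (hrlim.smul_const _).const_add _
      simpa [homot] using this
    exact (hu p hp).tendsto.comp (tendsto_nhdsWithin_iff.2
      ⟨h1, .of_forall fun n => interior_subset (hmap n p hp)⟩)
  have key : ∀ n, volume.real Q * (u (homot z z (r n) c) - u (homot z z (r n) (c + a)) -
      u (homot z z (r n) (c + b)) + u (homot z z (r n) (c + a + b))) =
      bil (fun i j => ∫ x in homot z z (r n) '' Q, H i j x) a b := by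
    intro n
    have hrn := (hr0 n).1.ne'
    have hr2 : r n ^ 2 ≠ 0 := pow_ne_zero 2 hrn
    have hk := h (homot z z (r n) c) (r n • a) (r n • b)
      (by rw [det2_smul_smul]; exact mul_ne_zero hr2 hab)
      (by
        rw [← homot_image_para]
        rintro _ ⟨x, hx, rfl⟩
        exact hmap n x (hc hx))
    rw [← homot_image_para, volume_image_homot _ _ hrn hQ.isClosed.measurableSet] at hk
    have e1 : homot z z (r n) c + r n • a = homot z z (r n) (c + a) := by
      apply plane_ext <;> simp [homot] <;> ring
    have e2 : homot z z (r n) c + r n • b = homot z z (r n) (c + b) := by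
      apply plane_ext <;> simp [homot] <;> ring
    have e3 : homot z z (r n) (c + a) + r n • b = homot z z (r n) (c + a + b) := by
      apply plane_ext <;> simp [homot] <;> ring
    rw [e1, e2, e3] at hk
    apply mul_left_cancel₀ hr2
    rw [← mul_assoc, hk]
    simp only [bil, PiLp.smul_apply, smul_eq_mul]
    ring
  have hL := ((((hlim c p00).sub (hlim _ p10)).sub (hlim _ p01)).add (hlim _ p11)).const_mul
    (volume.real Q)
  have hR1 : ∀ i j, Tendsto (fun n => ∫ x in homot z z (r n) '' Q, H i j x) atTop
      (𝓝 (∫ x in Q, H i j x)) := by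
    intro i j
    have e : ∀ S : Set Plane, MeasurableSet S → S ⊆ K →
        ∫ x in S, H i j x = ∫ x in K, S.indicator (H i j) x := by
      intro S hS hSK
      rw [setIntegral_indicator hS, inter_eq_self_of_subset_right hSK]
    have hQn : ∀ n, IsCompact (homot z z (r n) '' Q) := fun n =>
      hQ.image (continuous_homot _ _ _)
    rw [e Q hQ.isClosed.measurableSet hc]
    have : ∀ n, ∫ x in homot z z (r n) '' Q, H i j x =
        ∫ x in K, (homot z z (r n) '' Q).indicator (H i j) x := fun n =>
      e _ (hQn n).isClosed.measurableSet (by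
        rintro _ ⟨x, hx, rfl⟩
        exact interior_subset (hmap n x (hc hx)))
    simp only [this]
    refine tendsto_integral_of_dominated_convergence (fun x => |H i j x|)
      (fun n => (hH i j).aestronglyMeasurable.indicator (hQn n).isClosed.measurableSet)
      (hH i j).abs (fun n => .of_forall fun x => ?_) ?_
    · rw [← Real.norm_eq_abs]; exact norm_indicator_le_norm_self _ _
    · have hfr : ∀ᵐ x ∂(volume.restrict K), x ∉ frontier Q :=
        ae_restrict_of_ae (measure_eq_zero_iff_ae_notMem.1
          ((convex_para c a b).addHaar_frontier volume))
      filter_upwards [hfr] with x hx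
      refine tendsto_const_nhds.congr' ?_
      -- Away from the frontier of `Q`, membership in the contracted set is eventually the same as
      -- membership in `Q`.
      have ht := (homot_self_continuousAt z x).comp hrlim
      by_cases hxi : x ∈ interior Q
      · filter_upwards [ht.eventually (isOpen_interior.mem_nhds hxi)] with n hn
        have h1 : x ∈ homot z z (r n) '' Q :=
          (mem_image_homot_self z x (hr0 n).1.ne' Q).2 (interior_subset hn)
        rw [indicator_of_mem (interior_subset hxi), indicator_of_mem h1]
      · have hxc : x ∈ Qᶜ := fun h => hx ⟨subset_closure h, hxi⟩
        filter_upwards [ht.eventually (hQ.isClosed.isOpen_compl.mem_nhds hxc)] with n hn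
        have h1 : x ∉ homot z z (r n) '' Q :=
          fun h => hn ((mem_image_homot_self z x (hr0 n).1.ne' Q).1 h)
        rw [indicator_of_notMem hxc, indicator_of_notMem h1]
  have hR : Tendsto (fun n => bil (fun i j => ∫ x in homot z z (r n) '' Q, H i j x) a b) atTop
      (𝓝 (bil (fun i j => ∫ x in Q, H i j x) a b)) := by
    unfold bil
    exact (((((hR1 0 0).mul_const _).mul_const _).add (((hR1 0 1).mul_const _).mul_const _)).add
      (((hR1 1 0).mul_const _).mul_const _)).add (((hR1 1 1).mul_const _).mul_const _)
  exact tendsto_nhds_unique (hL.congr key) hR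

/-- The symmetrized weak Hessian of a function in `V^L(K)`. -/
theorem exists_hasHessian {P : Fin 3 → Plane} (hP : Nondeg P) {u : Plane → ℝ} (hu : u ∈ VL P) :
    ∃ H, HasHessian (tri P) u H ∧
      energy P H (fun _ _ => 0) ≤ h2SeminormSq (interior (tri P)) u := by
  obtain ⟨hH2, hcont, -⟩ := hu
  set K := tri P with hK
  set U := interior K with hU
  have hUo : IsOpen U := isOpen_interior
  have hUK : volume.restrict U = volume.restrict K :=
    Measure.restrict_congr_set (interior_ae_eq_of_convex (convex_tri P))
  have : IsFiniteMeasure (volume.restrict K) :=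
    isFiniteMeasure_restrict.2 (isCompact_tri P).measure_lt_top.ne
  set G : Fin 2 → Fin 2 → Plane → ℝ := fun i j => weakPartial U j (weakPartial U i u) with hG
  have hGp : ∀ i j, MemLp (G i j) 2 (volume.restrict K) := fun i j => by
    rw [← hUK]; exact (hH2.hessian hUo i j).1
  have hG1 : ∀ i j, IntegrableOn (G i j) K := fun i j => (hGp i j).integrable one_le_two
  have hG2 : ∀ i j, IntegrableOn (fun x => G i j x ^ 2) K := fun i j => (hGp i j).integrable_sq
  have hcU := hcont.mono interior_subset
  have huU : IntegrableOn u U :=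
    (hcont.integrableOn_compact (isCompact_tri P)).mono_set interior_subset
  obtain ⟨z, hz⟩ := interior_tri_nonempty hP
  have hsd : ∀ c a b, det2 a b ≠ 0 → para c a b ⊆ K →
      volume.real (para c a b) * (u c - u (c + a) - u (c + b) + u (c + a + b)) =
        bil (fun i j => ∫ x in para c a b, G i j x) a b := by
    intro c a b hab hc
    refine second_difference_of_interior (convex_tri P) hz hcont hG1
      (fun c a b hab hc => ?_) hab hc
    exact second_difference_of_weak hUo hcU huU (fun i j => (hG1 i j).mono_set interior_subset)
      (fun i j => (hH2.hessian hUo i j).2) hab hc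
  have hs1 : ∀ i j, IntegrableOn (fun x => (G i j x + G j i x) / 2) K := fun i j =>
    ((hG1 i j).add (hG1 j i)).div_const 2
  have hsp : ∀ i j, MemLp (fun x => (G i j x + G j i x) / 2) 2 (volume.restrict K) := fun i j => by
    have := ((hGp i j).add (hGp j i)).const_mul (1 / 2)
    refine this.ae_eq (.of_forall fun x => ?_)
    simp only [Pi.add_apply]; ring
  -- Averaging with the transpose makes the field symmetric without invoking symmetry of mixed weak
  -- derivatives. Exchanging `a` and `b` gives the identity for the transpose, and convexity of the
  -- square keeps the energy from growing.
  refine ⟨fun i j x => (G i j x + G j i x) / 2, ⟨hcont, fun i j x => by ring, hs1,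
    fun i j => (hsp i j).integrable_sq, ?_⟩, ?_⟩
  · intro c a b hab hc
    have hab' : det2 b a ≠ 0 := by
      have : det2 b a = -det2 a b := by simp [det2]; ring
      rw [this]; exact neg_ne_zero.2 hab
    have k1 := hsd c a b hab hc
    have k2 := hsd c b a hab' (by rwa [para_comm])
    rw [para_comm c b a, add_right_comm c b a] at k2
    have hi : ∀ i j, ∫ x in para c a b, (G i j x + G j i x) / 2 =
        ((∫ x in para c a b, G i j x) + ∫ x in para c a b, G j i x) / 2 := fun i j => by
      rw [integral_div, integral_add ((hG1 i j).mono_set hc) ((hG1 j i).mono_set hc)]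
    simp only [bil, hi] at k1 k2 ⊢
    linear_combination k1 / 2 + k2 / 2
  · have hle : ∀ i j, ∫ x in K, ((G i j x + G j i x) / 2 - 0) ^ 2 ≤
        ((∫ x in K, G i j x ^ 2) + ∫ x in K, G j i x ^ 2) / 2 := by
      intro i j
      rw [← integral_add (hG2 i j) (hG2 j i), ← integral_div]
      simp only [sub_zero]
      refine integral_mono (hsp i j).integrable_sq (((hG2 i j).add (hG2 j i)).div_const 2)
        fun x => ?_
      simp only
      nlinarith [sq_nonneg (G i j x - G j i x)]
    unfold energy h2SeminormSq
    rw [hUK]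
    simp only [Fin.sum_univ_two]
    have l00 := hle 0 0
    have l01 := hle 0 1
    have l10 := hle 1 0
    have l11 := hle 1 1
    simp only [hG] at l00 l01 l10 l11 ⊢
    linarith

/-! ### Smooth functions belong to `H²` -/

theorem isWeakPartial_of_contDiff (U : Set Plane) {f : Plane → ℝ}
    (hf : ContDiff ℝ ∞ f) (i : Fin 2) : IsWeakPartial U i f (partialDeriv i f) := by
  have hf' := partialDeriv_contDiff hf i
  refine ⟨hf'.continuous.locallyIntegrable.locallyIntegrableOn U, fun φ h1 h2 h3 => ?_⟩
  have h1' := partialDeriv_contDiff h1 i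
  rw [setIntegral_mul_of_tsupport_subset ((partialDeriv_tsupport φ i).trans h3),
    setIntegral_mul_of_tsupport_subset h3]
  have hloc : ∀ g : Plane → ℝ, Continuous g → LocallyIntegrableOn g univ := fun g hg =>
    hg.locallyIntegrable.locallyIntegrableOn univ
  exact integral_mul_fderiv_eq_neg_fderiv_mul_of_integrable
    (integrable_mul_of_tsupport_subset (hloc _ hf'.continuous) h1.continuous h2 (subset_univ _))
    (integrable_mul_of_tsupport_subset (hloc _ hf.continuous) h1'.continuous
      (partialDeriv_hasCompactSupport h2 i) (subset_univ _))
    (integrable_mul_of_tsupport_subset (hloc _ hf.continuous) h1.continuous h2 (subset_univ _))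
    (fun x _ => hf.differentiable (by simp) x) (fun x _ => h1.differentiable (by simp) x)

theorem memH2_of_contDiff {K : Set Plane} (hK : IsCompact K) {f : Plane → ℝ}
    (hf : ContDiff ℝ ∞ f) : MemH2 (interior K) f := by
  have hmem : ∀ g : Plane → ℝ, ContDiff ℝ ∞ g → MemLp g 2 (volume.restrict (interior K)) := by
    intro g hg
    obtain ⟨M, hM⟩ := hK.exists_bound_of_continuousOn hg.continuous.continuousOn
    have : IsFiniteMeasure (volume.restrict (interior K)) := isFiniteMeasure_restrict.2
      ((measure_mono interior_subset).trans_lt hK.measure_lt_top).ne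
    refine MemLp.of_bound hg.continuous.aestronglyMeasurable M ?_
    exact (ae_restrict_iff' isOpen_interior.measurableSet).2
      (.of_forall fun x hx => hM x (interior_subset hx))
  refine ⟨hmem f hf, fun i => partialDeriv i f, fun i j => partialDeriv j (partialDeriv i f),
    fun i => ⟨isWeakPartial_of_contDiff _ hf i, hmem _ (partialDeriv_contDiff hf i)⟩,
    fun i j => ⟨isWeakPartial_of_contDiff _ (partialDeriv_contDiff hf i) j,
      hmem _ (partialDeriv_contDiff (partialDeriv_contDiff hf i) j)⟩⟩

/-- `V^L(K)` contains a nonzero function. -/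
theorem exists_mem_VL {P : Fin 3 → Plane} (hP : Nondeg P) :
    ∃ u ∈ VL P, linftyNorm (tri P) u ≠ 0 := by
  -- With identity Hessian and zero vertex values, `q` equals `-|P 1 - P 0|²/8` at the midpoint of
  -- the first edge, which is nonzero.
  obtain ⟨q, hq, hq0⟩ := exists_isQuad hP (S := fun i j => if i = j then 1 else 0) (by simp)
    (fun _ => 0)
  refine ⟨q, ⟨memH2_of_contDiff (isCompact_tri P) hq.contDiff, hq.continuous.continuousOn, hq0⟩,
    fun h0 => ?_⟩
  have hmid : (1 / 2 : ℝ) • (P 0 + P 1) ∈ tri P := by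
    have := point_mem_tri P (s := 1 / 2) (t := 0) (by norm_num) le_rfl (by norm_num)
    convert this using 1
    apply plane_ext <;> simp [point] <;> ring
  have h1 := abs_le_linftyNorm hP hq.continuous.continuousOn hmid
  rw [h0, hq.midpoint, hq0, hq0] at h1
  have h2 := abs_nonpos_iff.1 h1
  simp [bil] at h2
  have h3 : P 1 0 - P 0 0 = 0 := by nlinarith [sq_nonneg (P 1 1 - P 0 1), sq_nonneg (P 1 0 - P 0 0)]
  have h4 : P 1 1 - P 0 1 = 0 := by nlinarith [sq_nonneg (P 1 1 - P 0 1), sq_nonneg (P 1 0 - P 0 0)]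
  apply hP
  simp [det2, h3, h4]

/-! ### The lower bound for `lam` -/

theorem h2SeminormSq_nonneg (U : Set Plane) (u : Plane → ℝ) : 0 ≤ h2SeminormSq U u :=
  Finset.sum_nonneg fun _ _ => Finset.sum_nonneg fun _ _ => integral_nonneg fun _ => sq_nonneg _

/-- The eigenvalue bound on an arbitrary nondegenerate triangle. -/
theorem lamH_mul_le_lam {P : Fin 3 → Plane} (hP : Nondeg P) {N : ℕ} (hN : 1 ≤ N) :
    lamH P (uniformMesh P N) * (1 - (1 / (N : ℝ)) ^ 2) ≤ lam P := by
  -- Settles the cases `N = 1` and `lamH = 0`, where the left side vanishes and the constant in the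
  -- pointwise bound would divide by zero.
  have hlam0 : 0 ≤ lam P := by
    apply Real.sInf_nonneg
    rintro r ⟨u, -, -, rfl⟩
    exact div_nonneg (h2SeminormSq_nonneg _ _) (sq_nonneg _)
  rcases hN.eq_or_lt with rfl | hN2
  · simpa using hlam0
  rcases (lamH_nonneg P (uniformMesh P N)).eq_or_lt with h0 | hlam
  · rw [← h0, zero_mul]; exact hlam0
  have hN' : (2 : ℝ) ≤ N := by exact_mod_cast hN2
  have hn1 : 0 < 1 - (1 / (N : ℝ)) ^ 2 := by
    rw [sub_pos, div_pow, one_pow, div_lt_one (by positivity)]; nlinarith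
  -- The real infimum of the empty set is `0`, so an admissible function must be exhibited.
  refine le_csInf ?_ ?_
  · obtain ⟨u, hu, hu0⟩ := exists_mem_VL hP
    exact ⟨_, u, hu, hu0, rfl⟩
  · rintro r ⟨u, hu, hu0, rfl⟩
    obtain ⟨H, hH, hE⟩ := exists_hasHessian hP hu
    rw [le_div_iff₀ (by positivity)]
    have hb := linftyNorm_le (Real.sqrt_nonneg _)
      (fun x hx => abs_le_sqrt_energy hP hN2 hlam hH hu.2.2 hx)
    have hsq := pow_le_pow_left₀ ENNReal.toReal_nonneg hb 2
    have hA : 0 < lamH P (uniformMesh P N) * (1 - (1 / (N : ℝ)) ^ 2) := mul_pos hlam hn1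
    rw [Real.sq_sqrt (mul_nonneg (one_div_nonneg.2 hA.le) (energy_nonneg _ _ _)), one_div,
      ← div_eq_inv_mul, le_div_iff₀ hA, mul_comm] at hsq
    exact hsq.trans hE

theorem nondeg_vertices {α θ h : ℝ} (hh : 0 < h) (hα : 0 < α) (hθ0 : 0 < θ) (hθπ : θ < Real.pi) :
    Nondeg (vertices α θ h) := by
  have hs := Real.sin_pos_of_pos_of_lt_pi hθ0 hθπ
  have : det2 (vertices α θ h 1 - vertices α θ h 0) (vertices α θ h 2 - vertices α θ h 0) =
      h * (α * h * Real.sin θ) := by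
    simp [det2, vertices]
  unfold Nondeg
  rw [this]
  positivity

end FujinoMorley

theorem mainTheorem3 (α θ h : ℝ) (hh : 0 < h) (hα0 : 0 < α) (hα1 : α ≤ 1)
    (hθ : Real.arccos (α / 2) ≤ θ) (hθπ : θ < Real.pi) (N : ℕ) (hN : 1 ≤ N) :
    FujinoMorley.lamH (FujinoMorley.vertices α θ h)
        (FujinoMorley.uniformMesh (FujinoMorley.vertices α θ h) N) * (1 - (1 / (N : ℝ)) ^ 2)
      ≤ FujinoMorley.lam (FujinoMorley.vertices α θ h) := by
  have hθ0 : 0 < θ := lt_of_lt_of_le (Real.arccos_pos.2 (by linarith)) hθ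
  exact FujinoMorley.lamH_mul_le_lam (FujinoMorley.nondeg_vertices hh hα0 hθ0 hθπ) hN
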